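/- Let $N \ge 1$ and let $\Omega \subset \mathbb{R}^N$ be a smooth bounded domain (nonempty, open, connected, bounded, with smooth boundary). Let $a \colon \overline\Omega \times \mathbb{R} \to \mathbb{R}$ be smooth (up to the boundary of $\Omega$) with $a(x,s) \ge 1$ for all $x \in \Omega$, $s \in \mathbb{R}$, and suppose that there are $a_1 \in L^\infty(\Omega)$ and $b_1 \in L^2(\Omega)$ with $a(x,s) \le a_1(x)|s| + b_1(x)$ for almost every $x \in \Omega$ and all $s \in \mathbb{R}$. Let $\underline u, \overline u \in C(\overline\Omega)$ satisfy $\underline u \le \overline u$ on $\overline\Omega$, and let $a_2 \in L^2(\Omega)$ and $b_2 \in [0,\infty)$. Then the set of all $u \in H_0^1(\Omega) \cap L^\infty(\Omega)$ such that $\underline u \le u \le \overline u$ almost everywhere in $\Omega$ and \[ \left| \int_\Omega a(x,u)\, \nabla u \cdot \nabla v \, dx \right| \le \int_\Omega \left( a_2 + b_2 |\nabla u|^2 \right) |v| \, dx \qquad \text{for all } v \in H_0^1(\Omega) \cap L^\infty(\Omega) \] is compact in $H_0^1(\Omega)$ (for the norm topology). -/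

import Mathlib

open MeasureTheory Set Filter Topology
open scoped ContDiff ENNReal InnerProductSpace

namespace BernsteinNagumo

noncomputable section

/-- A smooth bounded domain of `ℝᴺ`: a nonempty, connected, bounded open set that near each of its
boundary points is the strict sublevel set of a smooth function with nonzero differential. -/
structure IsSmoothBoundedDomain {N : ℕ} (Ω : Set (EuclideanSpace ℝ (Fin N))) : Prop where
  isOpen : IsOpen Ω
  isConnected : IsConnected Ω
  isBounded : Bornology.IsBounded Ω
  smooth_boundary : ∀ x ∈ frontier Ω,
    ∃ (U : Set (EuclideanSpace ℝ (Fin N))) (ρ : EuclideanSpace ℝ (Fin N) → ℝ),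
      IsOpen U ∧ x ∈ U ∧ ContDiffOn ℝ ∞ ρ U ∧ (∀ y ∈ U, fderiv ℝ ρ y ≠ 0) ∧
        ρ x = 0 ∧ Ω ∩ U = {y ∈ U | ρ y < 0}

/-- Test functions: the elements of `C_c^∞(Ω)`, extended by zero to the whole space. -/
def IsTestFunction {N : ℕ} (Ω : Set (EuclideanSpace ℝ (Fin N)))
    (φ : EuclideanSpace ℝ (Fin N) → ℝ) : Prop :=
  ContDiff ℝ ∞ φ ∧ HasCompactSupport φ ∧ tsupport φ ⊆ Ω

/-- `g` is the weak (distributional) gradient of `u` on `Ω`. -/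
def HasWeakGradient {N : ℕ} (Ω : Set (EuclideanSpace ℝ (Fin N)))
    (u : EuclideanSpace ℝ (Fin N) → ℝ)
    (g : EuclideanSpace ℝ (Fin N) → EuclideanSpace ℝ (Fin N)) : Prop :=
  ∀ φ : EuclideanSpace ℝ (Fin N) → ℝ, IsTestFunction Ω φ →
    ∫ x in Ω, u x • gradient φ x = -∫ x in Ω, φ x • g x

/-- The product `L²(Ω) × L²(Ω; ℝᴺ)` with the norm `(‖u‖² + ‖g‖²)^{1/2}`. -/
abbrev L2Pair {N : ℕ} (Ω : Set (EuclideanSpace ℝ (Fin N))) : Type :=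
  WithLp 2 (Lp ℝ 2 (volume.restrict Ω) ×
    Lp (EuclideanSpace ℝ (Fin N)) 2 (volume.restrict Ω))

lemma IsTestFunction.memLp {N : ℕ} {Ω : Set (EuclideanSpace ℝ (Fin N))}
    {φ : EuclideanSpace ℝ (Fin N) → ℝ} (hφ : IsTestFunction Ω φ) :
    MemLp φ 2 (volume.restrict Ω) :=
  (hφ.1.continuous.memLp_of_hasCompactSupport hφ.2.1).restrict Ω

lemma IsTestFunction.continuous_gradient {N : ℕ} {Ω : Set (EuclideanSpace ℝ (Fin N))}
    {φ : EuclideanSpace ℝ (Fin N) → ℝ} (hφ : IsTestFunction Ω φ) :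
    Continuous (gradient φ) :=
  (InnerProductSpace.toDual ℝ (EuclideanSpace ℝ (Fin N))).symm.continuous.comp
    (hφ.1.continuous_fderiv (by simp))

lemma IsTestFunction.gradient_memLp {N : ℕ} {Ω : Set (EuclideanSpace ℝ (Fin N))}
    {φ : EuclideanSpace ℝ (Fin N) → ℝ} (hφ : IsTestFunction Ω φ) :
    MemLp (gradient φ) 2 (volume.restrict Ω) := by
  refine (hφ.continuous_gradient.memLp_of_hasCompactSupport ?_).restrict Ω
  exact (hφ.2.1.fderiv ℝ).comp_left
    (g := (InnerProductSpace.toDual ℝ (EuclideanSpace ℝ (Fin N))).symm) (map_zero _)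

/-- The Sobolev space `H¹(Ω)`: the pairs `(u, ∇u)` of an `L²` function and its weak gradient, when
the latter is in `L²`, with the norm `(‖u‖² + ‖∇u‖²)^{1/2}`. As the weak gradient is unique almost
everywhere, such a pair is the same thing as a function `u ∈ H¹(Ω)`. -/
def H1 {N : ℕ} (Ω : Set (EuclideanSpace ℝ (Fin N))) : Submodule ℝ (L2Pair Ω) where
  carrier := {w | HasWeakGradient Ω w.fst w.snd}
  zero_mem' := by
    intro φ hφ
    have h1 : ∫ x in Ω, (0 : L2Pair Ω).fst x • gradient φ x = 0 :=
      integral_eq_zero_of_ae (by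
        filter_upwards [Lp.coeFn_zero ℝ 2 (volume.restrict Ω)] with x hx
        simp only [WithLp.zero_fst, hx, Pi.zero_apply, zero_smul])
    have h2 : ∫ x in Ω, φ x • (0 : L2Pair Ω).snd x = 0 :=
      integral_eq_zero_of_ae (by
        filter_upwards [Lp.coeFn_zero (EuclideanSpace ℝ (Fin N)) 2 (volume.restrict Ω)] with x hx
        simp only [WithLp.zero_snd, hx, Pi.zero_apply, smul_zero])
    rw [h1, h2, neg_zero]
  add_mem' := by
    intro w z hw hz φ hφ
    have i1 : ∀ w : L2Pair Ω, Integrable (fun x => w.fst x • gradient φ x) (volume.restrict Ω) :=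
      fun w => memLp_one_iff_integrable.1 (hφ.gradient_memLp.smul (Lp.memLp w.fst))
    have i2 : ∀ w : L2Pair Ω, Integrable (fun x => φ x • w.snd x) (volume.restrict Ω) :=
      fun w => memLp_one_iff_integrable.1 ((Lp.memLp w.snd).smul hφ.memLp)
    have h1 : ∫ x in Ω, (w + z).fst x • gradient φ x
        = ∫ x in Ω, (w.fst x • gradient φ x + z.fst x • gradient φ x) :=
      integral_congr_ae (by
        filter_upwards [Lp.coeFn_add w.fst z.fst] with x hx
        simp only [WithLp.add_fst, hx, Pi.add_apply, add_smul])
    have h2 : ∫ x in Ω, φ x • (w + z).snd x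
        = ∫ x in Ω, (φ x • w.snd x + φ x • z.snd x) :=
      integral_congr_ae (by
        filter_upwards [Lp.coeFn_add w.snd z.snd] with x hx
        simp only [WithLp.add_snd, hx, Pi.add_apply, smul_add])
    rw [h1, h2, integral_add (i1 w) (i1 z), integral_add (i2 w) (i2 z), hw φ hφ, hz φ hφ, neg_add]
  smul_mem' := by
    intro c w hw φ hφ
    have h1 : ∫ x in Ω, (c • w).fst x • gradient φ x
        = ∫ x in Ω, c • (w.fst x • gradient φ x) :=
      integral_congr_ae (by
        filter_upwards [Lp.coeFn_smul c w.fst] with x hx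
        simp [hx, smul_smul])
    have h2 : ∫ x in Ω, φ x • (c • w).snd x = ∫ x in Ω, c • (φ x • w.snd x) :=
      integral_congr_ae (by
        filter_upwards [Lp.coeFn_smul c w.snd] with x hx
        simp [hx, smul_comm c])
    rw [h1, h2, integral_smul, integral_smul, hw φ hφ, smul_neg]

/-- `H₀¹(Ω)`: the closure of `C_c^∞(Ω)` in `H¹(Ω)`. -/
def H01 {N : ℕ} (Ω : Set (EuclideanSpace ℝ (Fin N))) : Submodule ℝ (H1 Ω) :=
  (Submodule.span ℝ {w : H1 Ω | ∃ φ : EuclideanSpace ℝ (Fin N) → ℝ, IsTestFunction Ω φ ∧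
    (w : L2Pair Ω).fst =ᵐ[volume.restrict Ω] φ}).topologicalClosure

/-- The function underlying an element of `H₀¹(Ω)`. -/
def sobolevFun {N : ℕ} {Ω : Set (EuclideanSpace ℝ (Fin N))} (u : H01 Ω) :
    EuclideanSpace ℝ (Fin N) → ℝ :=
  ((u : H1 Ω) : L2Pair Ω).fst

/-- The weak gradient of an element of `H₀¹(Ω)`. -/
def sobolevGrad {N : ℕ} {Ω : Set (EuclideanSpace ℝ (Fin N))} (u : H01 Ω) :
    EuclideanSpace ℝ (Fin N) → EuclideanSpace ℝ (Fin N) :=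
  ((u : H1 Ω) : L2Pair Ω).snd

/-- An element of `H₀¹(Ω)` lies in `L^∞(Ω)`. -/
def IsLinfty {N : ℕ} {Ω : Set (EuclideanSpace ℝ (Fin N))} (u : H01 Ω) : Prop :=
  MemLp (sobolevFun u) ∞ (volume.restrict Ω)

/-- The weak inequality
`|∫_Ω a(x, u) ∇u · ∇v dx| ≤ ∫_Ω (a₂ + b₂ |∇u|²) |v| dx` for all `v ∈ H₀¹(Ω) ∩ L^∞(Ω)`. -/
def SatisfiesInequality {N : ℕ} {Ω : Set (EuclideanSpace ℝ (Fin N))}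
    (a : EuclideanSpace ℝ (Fin N) → ℝ → ℝ) (a₂ : EuclideanSpace ℝ (Fin N) → ℝ) (b₂ : ℝ)
    (u : H01 Ω) : Prop :=
  ∀ v : H01 Ω, IsLinfty v →
    |∫ x in Ω, a x (sobolevFun u x) * ⟪sobolevGrad u x, sobolevGrad v x⟫_ℝ| ≤
      ∫ x in Ω, (a₂ x + b₂ * ‖sobolevGrad u x‖ ^ 2) * |sobolevFun v x|

/-- The set of all `u ∈ H₀¹(Ω) ∩ L^∞(Ω)` with `ulo ≤ u ≤ uhi` almost everywhere in `Ω` that satisfy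
the weak inequality. -/
def solutionSet {N : ℕ} (Ω : Set (EuclideanSpace ℝ (Fin N)))
    (a : EuclideanSpace ℝ (Fin N) → ℝ → ℝ) (a₂ : EuclideanSpace ℝ (Fin N) → ℝ) (b₂ : ℝ)
    (ulo uhi : EuclideanSpace ℝ (Fin N) → ℝ) : Set (H01 Ω) :=
  {u | IsLinfty u ∧ (∀ᵐ x ∂volume.restrict Ω, ulo x ≤ sobolevFun u x ∧ sobolevFun u x ≤ uhi x) ∧
    SatisfiesInequality a a₂ b₂ u}

end

end BernsteinNagumo

/-! The quadratic term `b₂ |∇u|²` is just integrable, so weak convergence in `H₀¹` does not control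
it. The remedy is a nonlinear test function. Take `F` smooth and bounded, with bounded derivative,
`F 0 = 0` and `F' ≥ 1/2 + 2 b₂ |F|` on `[-2M, 2M]`, where `M` bounds all solutions
(`exists_smooth_dominating`). For `w = u - z` with `u`, `z` bounded by `M`, testing with `F(w)`
gives `∫ a F'(w) ∇u · ∇w ≤ ∫ (a₂ + b₂ |∇u|²) |F(w)|`. Since `|∇u|² ≤ 2 |∇w|² + 2 |∇z|²` and `a ≥ 1`,
the part quadratic in `∇w` is absorbed on the left, leaving (`SatisfiesInequality.energy_le`) `1/2 ∫
|∇w|² ≤ ∫ |a₂| |F(w)| + 2 b₂ ∫ |∇z|² |F(w)| - ∫ a(x,u) F'(w) ∇z · ∇w`.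

This estimate is used twice. With `z = 0` it bounds the solutions in `H₀¹` (`exists_norm_le`). With
`u = uₙ` converging to `z` weakly and almost everywhere, every term on the right tends to zero: the
first two by dominated convergence, the last as the pairing of a strongly convergent sequence with a
weakly null one. Hence `uₙ → z` in norm (`tendsto_of_weak`), and strong convergence lets the
inequality pass to the limit (`SatisfiesInequality.of_tendsto`).

The almost everywhere convergence comes from Rellich's theorem (`tendsto_integral_sobolevFun_sq`),
proved by comparing test functions with their averages on small balls. That `F(u - z)` is an
admissible test function is the chain rule `exists_comp_left`. -/

namespace BernsteinNagumo

noncomputable section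

/-! ### Weak convergence in Hilbert spaces -/

section Hilbert

variable {H : Type*} [NormedAddCommGroup H] [InnerProductSpace ℝ H] [CompleteSpace H]

/-- A bounded sequence of a separable Hilbert space has a weakly convergent subsequence. -/
lemma exists_subseq_tendsto_inner [TopologicalSpace.SeparableSpace H] {x : ℕ → H} {C : ℝ}
    (hx : ∀ n, ‖x n‖ ≤ C) :
    ∃ (z : H) (k : ℕ → ℕ), StrictMono k ∧
      ∀ y, Tendsto (fun n => ⟪x (k n), y⟫_ℝ) atTop (𝓝 ⟪z, y⟫_ℝ) := by
  -- Sequential Banach–Alaoglu in the dual, transported by the Riesz isomorphism.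
  obtain ⟨f, -, k, hk, hf⟩ := WeakDual.isSeqCompact_closedBall ℝ H 0 C
    (x := fun n => StrongDual.toWeakDual (InnerProductSpace.toDual ℝ H (x n))) (fun n => by
      simpa using hx n)
  refine ⟨(InnerProductSpace.toDual ℝ H).symm (WeakDual.toStrongDual f), k, hk, fun y => ?_⟩
  have h := ((WeakDual.eval_continuous (𝕜 := ℝ) y).tendsto f).comp hf
  rw [InnerProductSpace.toDual_symm_apply]
  exact h

/-- A closed subspace of a Hilbert space is weakly sequentially closed. -/
lemma mem_of_tendsto_inner {K : Submodule ℝ H} (hK : IsClosed (K : Set H)) {x : ℕ → H} {z : H}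
    (hx : ∀ n, x n ∈ K) (h : ∀ y, Tendsto (fun n => ⟪x n, y⟫_ℝ) atTop (𝓝 ⟪z, y⟫_ℝ)) : z ∈ K := by
  -- `K` is its own double orthogonal complement, and orthogonality to a fixed `y` survives weak
  -- limits.
  rw [← hK.submodule_topologicalClosure_eq, ← Submodule.orthogonal_orthogonal_eq_closure]
  intro y hy
  have h0 : ∀ n, ⟪x n, y⟫_ℝ = 0 := fun n => hy _ (hx n)
  have := h y
  simp only [h0] at this
  rw [real_inner_comm]
  exact (tendsto_nhds_unique this tendsto_const_nhds)

end Hilbert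

/-! ### Norms, dominated convergence and subsequences in `L²` -/

section L2

variable {α : Type*} {m : MeasurableSpace α} {μ : Measure α}
variable {F : Type*} [NormedAddCommGroup F] [InnerProductSpace ℝ F]

lemma Lp_norm_sq_eq_integral (f : Lp F 2 μ) : ‖f‖ ^ 2 = ∫ x, ‖f x‖ ^ 2 ∂μ := by
  rw [← real_inner_self_eq_norm_sq, L2.inner_def]
  simp

lemma norm_sub_sq_eq_integral {f g : Lp F 2 μ} {f' g' : α → F} (hf : f =ᵐ[μ] f') (hg : g =ᵐ[μ] g') :
    ‖f - g‖ ^ 2 = ∫ x, ‖f' x - g' x‖ ^ 2 ∂μ := by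
  rw [Lp_norm_sq_eq_integral]
  refine integral_congr_ae ?_
  filter_upwards [Lp.coeFn_sub f g, hf, hg] with x h1 h2 h3
  rw [h1, Pi.sub_apply, h2, h3]

lemma inner_eq_integral {f g : Lp F 2 μ} {f' g' : α → F} (hf : f =ᵐ[μ] f') (hg : g =ᵐ[μ] g') :
    ⟪f, g⟫_ℝ = ∫ x, ⟪f' x, g' x⟫_ℝ ∂μ := by
  rw [L2.inner_def]
  refine integral_congr_ae ?_
  filter_upwards [hf, hg] with x h2 h3
  rw [h2, h3]

lemma integrable_norm_sq {V : Type*} [NormedAddCommGroup V] {f : α → V}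
    (hf : MemLp f 2 μ) : Integrable (fun x => ‖f x‖ ^ 2) μ :=
  (memLp_two_iff_integrable_sq_norm hf.1).1 hf

lemma integrable_inner_of_memLp {f g : α → F} (hf : MemLp f 2 μ) (hg : MemLp g 2 μ) :
    Integrable (fun x => ⟪f x, g x⟫_ℝ) μ := by
  refine ((integrable_norm_sq hf).add (integrable_norm_sq hg)).mono' (hf.1.inner hg.1) ?_
  refine Eventually.of_forall fun x => ?_
  have := abs_real_inner_le_norm (f x) (g x)
  simp only [Real.norm_eq_abs, Pi.add_apply]
  nlinarith [sq_nonneg (‖f x‖ - ‖g x‖), sq_nonneg (‖f x‖ + ‖g x‖)]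

/-- Dominated convergence in `L²`. -/
lemma tendsto_integral_norm_sub_sq {V : Type*} [NormedAddCommGroup V] {f : ℕ → α → V}
    {g : α → V} {B : α → ℝ}
    (hf : ∀ n, AEStronglyMeasurable (f n) μ) (hB : MemLp B 2 μ)
    (hbd : ∀ n, ∀ᵐ x ∂μ, ‖f n x‖ ≤ B x) (hlim : ∀ᵐ x ∂μ, Tendsto (fun n => f n x) atTop (𝓝 (g x))) :
    Tendsto (fun n => ∫ x, ‖f n x - g x‖ ^ 2 ∂μ) atTop (𝓝 0) := by
  have hg : AEStronglyMeasurable g μ := aestronglyMeasurable_of_tendsto_ae _ hf hlim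
  have hgb : ∀ᵐ x ∂μ, ‖g x‖ ≤ B x := by
    filter_upwards [hlim, ae_all_iff.2 hbd] with x h1 h2
    exact le_of_tendsto h1.norm (Eventually.of_forall h2)
  have := tendsto_integral_of_dominated_convergence (μ := μ) (F := fun n x => ‖f n x - g x‖ ^ 2)
    (f := fun _ => 0) (fun x => 4 * B x ^ 2) (fun n => ((hf n).sub hg).norm.pow 2)
    (hB.integrable_sq.const_mul 4) (fun n => ?_) ?_
  · simpa using this
  · filter_upwards [hbd n, hgb] with x h1 h2
    have := norm_sub_le (f n x) (g x)
    rw [Real.norm_eq_abs, abs_of_nonneg (by positivity)]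
    nlinarith [norm_nonneg (f n x - g x)]
  · filter_upwards [hlim] with x hx
    have h := ((hx.sub_const (g x)).norm.pow 2)
    simpa using h

/-- Convergence in `L²` implies almost everywhere convergence along a subsequence. -/
lemma exists_subseq_tendsto_ae {f : ℕ → α → F} {g : α → F}
    (hf : ∀ n, MemLp (f n) 2 μ) (hg : MemLp g 2 μ)
    (h : Tendsto (fun n => ∫ x, ‖f n x - g x‖ ^ 2 ∂μ) atTop (𝓝 0)) :
    ∃ k : ℕ → ℕ, StrictMono k ∧ ∀ᵐ x ∂μ, Tendsto (fun n => f (k n) x) atTop (𝓝 (g x)) := by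
  have h1 : Tendsto (fun n => (hf n).toLp (f n)) atTop (𝓝 (hg.toLp g)) := by
    rw [tendsto_iff_norm_sub_tendsto_zero]
    have h2 : (fun n => ‖(hf n).toLp (f n) - hg.toLp g‖) =
        fun n => Real.sqrt (∫ x, ‖f n x - g x‖ ^ 2 ∂μ) := by
      ext n
      rw [← norm_sub_sq_eq_integral (hf n).coeFn_toLp hg.coeFn_toLp, Real.sqrt_sq (norm_nonneg _)]
    rw [h2]
    simpa using h.sqrt
  obtain ⟨k, hk, hk'⟩ := (tendstoInMeasure_of_tendsto_Lp h1).exists_seq_tendsto_ae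
  refine ⟨k, hk, ?_⟩
  filter_upwards [hk', ae_all_iff.2 (fun n => (hf n).coeFn_toLp), hg.coeFn_toLp] with x h1 h2 h3
  simpa only [h2, h3] using h1

end L2

/-! ### Test functions, weak gradients and `H₀¹(Ω)` -/

section Sobolev

variable {N : ℕ} {Ω : Set (EuclideanSpace ℝ (Fin N))}

lemma IsTestFunction.differentiable {φ : EuclideanSpace ℝ (Fin N) → ℝ} (hφ : IsTestFunction Ω φ) :
    Differentiable ℝ φ := hφ.1.differentiable (by simp)

lemma IsTestFunction.hasCompactSupport_gradient {φ : EuclideanSpace ℝ (Fin N) → ℝ}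
    (hφ : IsTestFunction Ω φ) : HasCompactSupport (gradient φ) :=
  (hφ.2.1.fderiv ℝ).comp_left
    (g := (InnerProductSpace.toDual ℝ (EuclideanSpace ℝ (Fin N))).symm) (map_zero _)

lemma IsTestFunction.eq_zero {φ : EuclideanSpace ℝ (Fin N) → ℝ}
    (hφ : IsTestFunction Ω φ) {x : EuclideanSpace ℝ (Fin N)} (hx : x ∉ Ω) : φ x = 0 :=
  image_eq_zero_of_notMem_tsupport fun h => hx (hφ.2.2 h)

lemma gradient_eq_zero_of_notMem_tsupport {φ : EuclideanSpace ℝ (Fin N) → ℝ}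
    {x : EuclideanSpace ℝ (Fin N)} (hx : x ∉ tsupport φ) : gradient φ x = 0 := by
  have : fderiv ℝ φ x = 0 := by
    by_contra h
    exact hx (support_fderiv_subset ℝ (f := φ) h)
  simp [gradient, this]

lemma IsTestFunction.gradient_eq_zero {φ : EuclideanSpace ℝ (Fin N) → ℝ}
    (hφ : IsTestFunction Ω φ) {x : EuclideanSpace ℝ (Fin N)} (hx : x ∉ Ω) : gradient φ x = 0 :=
  gradient_eq_zero_of_notMem_tsupport fun h => hx (hφ.2.2 h)

lemma IsTestFunction.add {φ ψ : EuclideanSpace ℝ (Fin N) → ℝ} (hφ : IsTestFunction Ω φ)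
    (hψ : IsTestFunction Ω ψ) : IsTestFunction Ω (φ + ψ) :=
  ⟨hφ.1.add hψ.1, hφ.2.1.add hψ.2.1, (tsupport_add φ ψ).trans (union_subset hφ.2.2 hψ.2.2)⟩

lemma IsTestFunction.const_smul {φ : EuclideanSpace ℝ (Fin N) → ℝ} (hφ : IsTestFunction Ω φ)
    (c : ℝ) : IsTestFunction Ω (c • φ) :=
  ⟨hφ.1.const_smul c, hφ.2.1.smul_left (f := fun _ => c),
    (tsupport_smul_subset_right (fun _ => c) φ).trans hφ.2.2⟩

lemma IsTestFunction.smul_const_memLp {φ : EuclideanSpace ℝ (Fin N) → ℝ}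
    (hφ : IsTestFunction Ω φ) (c : EuclideanSpace ℝ (Fin N)) :
    MemLp (fun x => φ x • c) 2 (volume.restrict Ω) :=
  ((hφ.1.continuous.smul continuous_const).memLp_of_hasCompactSupport
    hφ.2.1.smul_right).restrict Ω

lemma isTestFunction_zero : IsTestFunction Ω 0 :=
  ⟨contDiff_const, HasCompactSupport.zero, by simp [tsupport]⟩

lemma inner_gradient {φ : EuclideanSpace ℝ (Fin N) → ℝ} (x c : EuclideanSpace ℝ (Fin N)) :
    ⟪gradient φ x, c⟫_ℝ = fderiv ℝ φ x c := by
  simp [gradient]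

/-- Integration by parts for a test function. -/
lemma IsTestFunction.hasWeakGradient {φ : EuclideanSpace ℝ (Fin N) → ℝ} (hφ : IsTestFunction Ω φ) :
    HasWeakGradient Ω φ (gradient φ) := by
  intro ψ hψ
  -- Both integrands vanish off `Ω`, so integration by parts takes place on the whole space, without
  -- boundary terms.
  rw [setIntegral_eq_integral_of_forall_compl_eq_zero (fun x hx => by simp [hφ.eq_zero hx]),
    setIntegral_eq_integral_of_forall_compl_eq_zero (fun x hx => by simp [hψ.eq_zero hx])]
  have i1 : Integrable (fun x => φ x • gradient ψ x) :=
    (hφ.1.continuous.smul hψ.continuous_gradient).integrable_of_hasCompactSupport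
      (hφ.2.1.smul_right)
  have i2 : Integrable (fun x => ψ x • gradient φ x) :=
    (hψ.1.continuous.smul hφ.continuous_gradient).integrable_of_hasCompactSupport
      (hψ.2.1.smul_right)
  have i3 : Integrable (fun x => φ x * ψ x) :=
    (hφ.1.continuous.mul hψ.1.continuous).integrable_of_hasCompactSupport (hφ.2.1.mul_right)
  refine ext_inner_left ℝ fun c => ?_
  rw [inner_neg_right, ← integral_inner i1, ← integral_inner i2]
  have e : ∀ (f g : EuclideanSpace ℝ (Fin N) → ℝ) x,
      ⟪c, f x • gradient g x⟫_ℝ = f x * fderiv ℝ g x c := fun f g x => by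
    rw [inner_smul_right, real_inner_comm, inner_gradient]
  have j1 := i1.const_inner (𝕜 := ℝ) c
  have j2 := i2.const_inner (𝕜 := ℝ) c
  simp only [e] at j1 j2 ⊢
  rw [integral_mul_fderiv_eq_neg_fderiv_mul_of_integrable (by simpa only [mul_comm] using j2) j1 i3
    (fun x _ => hφ.differentiable x) (fun x _ => hψ.differentiable x)]
  simp only [mul_comm]

/-- Weak gradients are almost everywhere unique. -/
lemma HasWeakGradient.ae_eq (hΩ : IsOpen Ω) {u v : EuclideanSpace ℝ (Fin N) → ℝ}
    {g h : EuclideanSpace ℝ (Fin N) → EuclideanSpace ℝ (Fin N)}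
    (hu : HasWeakGradient Ω u g) (hv : HasWeakGradient Ω v h) (huv : u =ᵐ[volume.restrict Ω] v)
    (hg : MemLp g 2 (volume.restrict Ω)) (hh : MemLp h 2 (volume.restrict Ω)) :
    g =ᵐ[volume.restrict Ω] h := by
  -- Fundamental lemma of the calculus of variations, applied to `g - h`.
  have key := hΩ.ae_eq_zero_of_integral_contDiff_smul_eq_zero (f := fun x => g x - h x)
    (μ := (volume.restrict Ω)) ?_ ?_
  · rw [ae_restrict_iff' hΩ.measurableSet] at key
    rw [EventuallyEq, ae_restrict_iff' hΩ.measurableSet]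
    filter_upwards [key] with x hx hxΩ
    exact sub_eq_zero.1 (hx hxΩ hxΩ)
  · exact ((hg.sub hh).locallyIntegrable (by norm_num)).locallyIntegrableOn _
  · intro φ h1 h2 h3
    have hφ : IsTestFunction Ω φ := ⟨h1, h2, h3⟩
    have i1 : Integrable (fun x => φ x • g x) (volume.restrict Ω) :=
      memLp_one_iff_integrable.1 (hg.smul hφ.memLp)
    have i2 : Integrable (fun x => φ x • h x) (volume.restrict Ω) :=
      memLp_one_iff_integrable.1 (hh.smul hφ.memLp)
    simp only [smul_sub]
    rw [integral_sub i1 i2, ← neg_neg (∫ x in Ω, φ x • g x), ← hu φ hφ]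
    have : ∫ x in Ω, u x • gradient φ x = ∫ x in Ω, v x • gradient φ x :=
      integral_congr_ae (by filter_upwards [huv] with x hx; rw [hx])
    rw [this, hv φ hφ]
    simp

/-- The element of `H¹(Ω)` given by a test function. -/
def IsTestFunction.toH1 {φ : EuclideanSpace ℝ (Fin N) → ℝ} (hφ : IsTestFunction Ω φ) : H1 Ω :=
  ⟨WithLp.toLp 2 (hφ.memLp.toLp φ, hφ.gradient_memLp.toLp _), by
    intro ψ hψ
    have h1 := hφ.hasWeakGradient ψ hψ
    have e1 : ∫ x in Ω, (hφ.memLp.toLp φ) x • gradient ψ x = ∫ x in Ω, φ x • gradient ψ x :=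
      integral_congr_ae (by filter_upwards [hφ.memLp.coeFn_toLp] with x hx; rw [hx])
    have e2 : ∫ x in Ω, ψ x • (hφ.gradient_memLp.toLp _) x = ∫ x in Ω, ψ x • gradient φ x :=
      integral_congr_ae (by filter_upwards [hφ.gradient_memLp.coeFn_toLp] with x hx; rw [hx])
    exact e1.trans (h1.trans (congrArg _ e2.symm))⟩

/-- The generators of `H01` prescribe only the function component; uniqueness of weak gradients
forces the other component to be the classical gradient. -/
lemma IsTestFunction.eq_toH1 (hΩ : IsOpen Ω) {φ : EuclideanSpace ℝ (Fin N) → ℝ}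
    (hφ : IsTestFunction Ω φ) {w : H1 Ω}
    (hw : (w : L2Pair Ω).fst =ᵐ[volume.restrict Ω] φ) : w = hφ.toH1 := by
  have hg := HasWeakGradient.ae_eq hΩ (w.2 : HasWeakGradient Ω _ _) hφ.hasWeakGradient hw
    (Lp.memLp _) hφ.gradient_memLp
  refine Subtype.ext ((WithLp.ofLp_injective 2) (Prod.ext (Lp.ext ?_) (Lp.ext ?_)))
  · exact hw.trans hφ.memLp.coeFn_toLp.symm
  · exact hg.trans hφ.gradient_memLp.coeFn_toLp.symm

lemma IsTestFunction.toH1_mem {φ : EuclideanSpace ℝ (Fin N) → ℝ}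
    (hφ : IsTestFunction Ω φ) : hφ.toH1 ∈ H01 Ω :=
  Submodule.le_topologicalClosure _ (Submodule.subset_span ⟨φ, hφ, hφ.memLp.coeFn_toLp⟩)

/-- Elements of `H₀¹(Ω)` are limits of test functions. -/
lemma exists_isTestFunction_norm_sub_lt (hΩ : IsOpen Ω) (u : H01 Ω) {ε : ℝ} (hε : 0 < ε) :
    ∃ (φ : EuclideanSpace ℝ (Fin N) → ℝ) (hφ : IsTestFunction Ω φ),
      ‖(u : H1 Ω) - hφ.toH1‖ < ε := by
  obtain ⟨w, hw, hd⟩ := Metric.mem_closure_iff.1 (show (u : H1 Ω) ∈ closure _ from u.2) ε hε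
  have : ∃ φ : EuclideanSpace ℝ (Fin N) → ℝ, IsTestFunction Ω φ ∧
      (w : L2Pair Ω).fst =ᵐ[volume.restrict Ω] φ := by
    -- Test functions already form a subspace, so passing to the span adds nothing new.
    clear hd
    induction hw using Submodule.span_induction with
    | mem x h => exact h
    | zero => exact ⟨0, isTestFunction_zero, Lp.coeFn_zero ℝ 2 (volume.restrict Ω)⟩
    | add x y _ _ hx hy =>
      obtain ⟨φ, hφ, h1⟩ := hx
      obtain ⟨ψ, hψ, h2⟩ := hy
      exact ⟨φ + ψ, hφ.add hψ, (Lp.coeFn_add _ _).trans (h1.add h2)⟩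
    | smul c x _ hx =>
      obtain ⟨φ, hφ, h1⟩ := hx
      exact ⟨c • φ, hφ.const_smul c, (Lp.coeFn_smul _ _).trans (h1.const_smul c)⟩
  obtain ⟨φ, hφ, h⟩ := this
  rw [hφ.eq_toH1 hΩ h, dist_eq_norm] at hd
  exact ⟨φ, hφ, hd⟩

lemma L2Pair.norm_sub_sq_eq {v w : L2Pair Ω} {f f' : EuclideanSpace ℝ (Fin N) → ℝ}
    {g g' : EuclideanSpace ℝ (Fin N) → EuclideanSpace ℝ (Fin N)}
    (h1 : v.fst =ᵐ[volume.restrict Ω] f) (h2 : w.fst =ᵐ[volume.restrict Ω] f')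
    (h3 : v.snd =ᵐ[volume.restrict Ω] g) (h4 : w.snd =ᵐ[volume.restrict Ω] g') :
    ‖v - w‖ ^ 2 = (∫ x in Ω, ‖f x - f' x‖ ^ 2) + ∫ x in Ω, ‖g x - g' x‖ ^ 2 := by
  rw [WithLp.prod_norm_sq_eq_of_L2, ← norm_sub_sq_eq_integral h1 h2,
    ← norm_sub_sq_eq_integral h3 h4]
  rfl

lemma L2Pair.inner_eq {v w : L2Pair Ω} {f f' : EuclideanSpace ℝ (Fin N) → ℝ}
    {g g' : EuclideanSpace ℝ (Fin N) → EuclideanSpace ℝ (Fin N)}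
    (h1 : v.fst =ᵐ[volume.restrict Ω] f) (h2 : w.fst =ᵐ[volume.restrict Ω] f')
    (h3 : v.snd =ᵐ[volume.restrict Ω] g) (h4 : w.snd =ᵐ[volume.restrict Ω] g') :
    ⟪v, w⟫_ℝ = (∫ x in Ω, f x * f' x) + ∫ x in Ω, ⟪g x, g' x⟫_ℝ := by
  rw [WithLp.prod_inner_apply, ← inner_eq_integral h3 h4]
  refine congrArg₂ _ ((inner_eq_integral h1 h2).trans ?_) rfl
  simp [mul_comm]

lemma norm_sub_toH1_sq {φ : EuclideanSpace ℝ (Fin N) → ℝ} (hφ : IsTestFunction Ω φ) (u : H01 Ω) :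
    ‖(u : H1 Ω) - hφ.toH1‖ ^ 2 = (∫ x in Ω, ‖sobolevFun u x - φ x‖ ^ 2) +
      ∫ x in Ω, ‖sobolevGrad u x - gradient φ x‖ ^ 2 :=
  L2Pair.norm_sub_sq_eq EventuallyEq.rfl hφ.memLp.coeFn_toLp EventuallyEq.rfl
    hφ.gradient_memLp.coeFn_toLp

lemma norm_sub_sq_eq_add (u v : H01 Ω) :
    ‖u - v‖ ^ 2 = (∫ x in Ω, ‖sobolevFun u x - sobolevFun v x‖ ^ 2) +
      ∫ x in Ω, ‖sobolevGrad u x - sobolevGrad v x‖ ^ 2 :=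
  L2Pair.norm_sub_sq_eq EventuallyEq.rfl EventuallyEq.rfl EventuallyEq.rfl EventuallyEq.rfl

lemma memLp_sobolevFun (u : H01 Ω) : MemLp (sobolevFun u) 2 (volume.restrict Ω) := Lp.memLp _

lemma memLp_sobolevGrad (u : H01 Ω) : MemLp (sobolevGrad u) 2 (volume.restrict Ω) := Lp.memLp _

lemma sobolevFun_sub (u v : H01 Ω) :
    sobolevFun (u - v) =ᵐ[volume.restrict Ω] fun x => sobolevFun u x - sobolevFun v x :=
  Lp.coeFn_sub _ _

lemma sobolevGrad_sub (u v : H01 Ω) :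
    sobolevGrad (u - v) =ᵐ[volume.restrict Ω] fun x => sobolevGrad u x - sobolevGrad v x :=
  Lp.coeFn_sub _ _

lemma sobolevFun_zero : sobolevFun (0 : H01 Ω) =ᵐ[volume.restrict Ω] 0 := Lp.coeFn_zero _ _ _

lemma sobolevGrad_zero : sobolevGrad (0 : H01 Ω) =ᵐ[volume.restrict Ω] 0 := Lp.coeFn_zero _ _ _

/-- For each test function `φ` and each direction `c`, the defining identity says that `w` is
orthogonal to the fixed pair `(⟪c, ∇φ⟫, φ c)`; an intersection of such hyperplanes is closed. -/
lemma isClosed_H1 : IsClosed (H1 Ω : Set (L2Pair Ω)) := by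
  have hset : (H1 Ω : Set (L2Pair Ω)) =
      ⋂ (φ : EuclideanSpace ℝ (Fin N) → ℝ) (hφ : IsTestFunction Ω φ)
        (c : EuclideanSpace ℝ (Fin N)), {w | ⟪w, (WithLp.toLp 2
          ((hφ.gradient_memLp.const_inner (𝕜 := ℝ) c).toLp _,
            (hφ.smul_const_memLp c).toLp _) : L2Pair Ω)⟫_ℝ = 0} := by
    ext w
    simp only [SetLike.mem_coe, mem_iInter, mem_ofPred_eq]
    refine forall_congr' fun φ => forall_congr' fun hφ => ?_
    have i1 : Integrable (fun x => w.fst x • gradient φ x) (volume.restrict Ω) :=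
      memLp_one_iff_integrable.1 (hφ.gradient_memLp.smul (Lp.memLp w.fst))
    have i2 : Integrable (fun x => φ x • w.snd x) (volume.restrict Ω) :=
      memLp_one_iff_integrable.1 ((Lp.memLp w.snd).smul hφ.memLp)
    have key : ∀ c : EuclideanSpace ℝ (Fin N), ⟪w, (WithLp.toLp 2
          ((hφ.gradient_memLp.const_inner (𝕜 := ℝ) c).toLp _,
            (hφ.smul_const_memLp c).toLp _) : L2Pair Ω)⟫_ℝ =
        ⟪c, (∫ x in Ω, w.fst x • gradient φ x) + ∫ x in Ω, φ x • w.snd x⟫_ℝ := fun c => by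
      rw [inner_add_right, ← integral_inner i1, ← integral_inner i2]
      refine (L2Pair.inner_eq EventuallyEq.rfl
        (hφ.gradient_memLp.const_inner (𝕜 := ℝ) c).coeFn_toLp EventuallyEq.rfl
        (hφ.smul_const_memLp c).coeFn_toLp).trans ?_
      simp only [inner_smul_right, real_inner_comm]
    simp only [key]
    refine (eq_neg_iff_add_eq_zero (a := ∫ x in Ω, w.fst x • gradient φ x)).trans
      ⟨fun h c => by rw [h, inner_zero_right], fun h => inner_self_eq_zero.1 (h _)⟩
  rw [hset]
  refine isClosed_iInter fun φ => isClosed_iInter fun hφ => isClosed_iInter fun c => ?_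
  exact isClosed_eq (by fun_prop) continuous_const

instance : CompleteSpace (H1 Ω) := isClosed_H1.completeSpace_coe

/-- Weak limits are taken in the ambient product `L2Pair Ω`, so closedness is needed there and not
only inside `H1 Ω`. -/
lemma isClosed_map_H01 : IsClosed ((H01 Ω).map (H1 Ω).subtype : Set (L2Pair Ω)) := by
  rw [Submodule.map_coe]
  exact isClosed_H1.isClosedEmbedding_subtypeVal.isClosedMap _
    (Submodule.isClosed_topologicalClosure _)

/-- An `L²` limit of test functions whose gradients converge in `L²` lies in `H₀¹(Ω)`. -/
lemma exists_of_tendsto {φ : ℕ → EuclideanSpace ℝ (Fin N) → ℝ} (hφ : ∀ n, IsTestFunction Ω (φ n))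
    {f : EuclideanSpace ℝ (Fin N) → ℝ} {g : EuclideanSpace ℝ (Fin N) → EuclideanSpace ℝ (Fin N)}
    (hf : MemLp f 2 (volume.restrict Ω)) (hg : MemLp g 2 (volume.restrict Ω))
    (h1 : Tendsto (fun n => ∫ x in Ω, ‖φ n x - f x‖ ^ 2) atTop (𝓝 0))
    (h2 : Tendsto (fun n => ∫ x in Ω, ‖gradient (φ n) x - g x‖ ^ 2) atTop (𝓝 0)) :
    ∃ v : H01 Ω, sobolevFun v =ᵐ[volume.restrict Ω] f ∧ sobolevGrad v =ᵐ[volume.restrict Ω] g := by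
  set p : L2Pair Ω := WithLp.toLp 2 (hf.toLp f, hg.toLp g)
  have hp : p ∈ ((H01 Ω).map (H1 Ω).subtype : Set (L2Pair Ω)) := by
    refine isClosed_map_H01.mem_of_tendsto (f := fun n => ((hφ n).toH1 : L2Pair Ω)) (b := atTop) ?_
      (Eventually.of_forall fun n => Submodule.mem_map_of_mem (hφ n).toH1_mem)
    rw [tendsto_iff_norm_sub_tendsto_zero]
    have h3 : (fun n => ‖((hφ n).toH1 : L2Pair Ω) - p‖) = fun n => Real.sqrt
        ((∫ x in Ω, ‖φ n x - f x‖ ^ 2) + ∫ x in Ω, ‖gradient (φ n) x - g x‖ ^ 2) := by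
      ext n
      rw [← Real.sqrt_sq (norm_nonneg _)]
      congr 1
      exact L2Pair.norm_sub_sq_eq (hφ n).memLp.coeFn_toLp hf.coeFn_toLp
        (hφ n).gradient_memLp.coeFn_toLp hg.coeFn_toLp
    rw [h3]
    simpa using (h1.add h2).sqrt
  obtain ⟨v, hv, hvp⟩ := hp
  refine ⟨⟨v, hv⟩, ?_, ?_⟩
  · have : (v : L2Pair Ω).fst = p.fst := congrArg WithLp.fst hvp
    unfold sobolevFun
    rw [this]
    exact hf.coeFn_toLp
  · have : (v : L2Pair Ω).snd = p.snd := congrArg WithLp.snd hvp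
    unfold sobolevGrad
    rw [this]
    exact hg.coeFn_toLp

/-- Every element of `H₀¹(Ω)` is the limit of a sequence of test functions. -/
lemma exists_seq_tendsto (hΩ : IsOpen Ω) (u : H01 Ω) :
    ∃ φ : ℕ → EuclideanSpace ℝ (Fin N) → ℝ, (∀ n, IsTestFunction Ω (φ n)) ∧
      Tendsto (fun n => ∫ x in Ω, ‖φ n x - sobolevFun u x‖ ^ 2) atTop (𝓝 0) ∧
      Tendsto (fun n => ∫ x in Ω, ‖gradient (φ n) x - sobolevGrad u x‖ ^ 2) atTop (𝓝 0) := by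
  choose φ hφ h using fun n : ℕ => exists_isTestFunction_norm_sub_lt hΩ u
    (ε := 1 / ((n : ℝ) + 1)) (by positivity)
  have h0 : Tendsto (fun n => ‖(u : H1 Ω) - (hφ n).toH1‖ ^ 2) atTop (𝓝 0) := by
    have : Tendsto (fun n => ‖(u : H1 Ω) - (hφ n).toH1‖) atTop (𝓝 0) :=
      squeeze_zero (fun _ => norm_nonneg _) (fun n => (h n).le)
        tendsto_one_div_add_atTop_nhds_zero_nat
    simpa using this.pow 2
  simp only [norm_sub_toH1_sq] at h0
  have n1 : ∀ n, 0 ≤ ∫ x in Ω, ‖sobolevFun u x - φ n x‖ ^ 2 := fun n =>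
    integral_nonneg fun _ => by positivity
  have n2 : ∀ n, 0 ≤ ∫ x in Ω, ‖sobolevGrad u x - gradient (φ n) x‖ ^ 2 := fun n =>
    integral_nonneg fun _ => by positivity
  refine ⟨φ, hφ, ?_, ?_⟩
  · simp only [norm_sub_rev (φ _ _)]
    exact squeeze_zero n1 (fun n => le_add_of_nonneg_right (n2 n)) h0
  · simp only [norm_sub_rev (gradient _ _)]
    exact squeeze_zero n2 (fun n => le_add_of_nonneg_left (n1 n)) h0

end Sobolev

/-! ### The chain rule -/

section ChainRule

variable {N : ℕ} {Ω : Set (EuclideanSpace ℝ (Fin N))}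

lemma IsTestFunction.comp_left {φ : EuclideanSpace ℝ (Fin N) → ℝ} (hφ : IsTestFunction Ω φ)
    {F : ℝ → ℝ} (hF : ContDiff ℝ ∞ F) (h0 : F 0 = 0) : IsTestFunction Ω (fun x => F (φ x)) :=
  ⟨hF.comp hφ.1, hφ.2.1.comp_left h0,
    (closure_mono (Function.support_comp_subset h0 φ)).trans hφ.2.2⟩

lemma gradient_comp_left {φ : EuclideanSpace ℝ (Fin N) → ℝ} {F : ℝ → ℝ}
    {x : EuclideanSpace ℝ (Fin N)} (hF : DifferentiableAt ℝ F (φ x)) (hφ : DifferentiableAt ℝ φ x) :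
    gradient (fun y => F (φ y)) x = deriv F (φ x) • gradient φ x := by
  have h := hF.hasDerivAt.comp_hasFDerivAt x hφ.hasFDerivAt
  have h' : fderiv ℝ (fun y => F (φ y)) x = deriv F (φ x) • fderiv ℝ φ x := h.fderiv
  simp [gradient, h']

/-- The chain rule in `H₀¹(Ω)`. -/
lemma exists_comp_left (hΩ : IsOpen Ω) (u : H01 Ω) {F : ℝ → ℝ} (hF : ContDiff ℝ ∞ F)
    (h0 : F 0 = 0) {L : ℝ} (hL : ∀ s, |deriv F s| ≤ L) :
    ∃ v : H01 Ω, sobolevFun v =ᵐ[volume.restrict Ω] (fun x => F (sobolevFun u x)) ∧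
      sobolevGrad v =ᵐ[volume.restrict Ω] fun x => deriv F (sobolevFun u x) • sobolevGrad u x := by
  have hFd : Differentiable ℝ F := hF.differentiable (by simp)
  have hdc : Continuous (deriv F) := hF.continuous_deriv (by simp)
  have hLip : ∀ s t, |F s - F t| ≤ L * |s - t| := fun s t =>
    convex_univ.norm_image_sub_le_of_norm_deriv_le (fun x _ => hFd x) (fun x _ => hL x)
      (mem_univ t) (mem_univ s)
  obtain ⟨φ, hφ, h1, h2⟩ := exists_seq_tendsto hΩ u
  -- Almost everywhere convergence is needed because `deriv F` is merely continuous and bounded: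
  -- `deriv F (φₙ) ∇u` is handled by dominated convergence.
  obtain ⟨k, hk, hae⟩ := exists_subseq_tendsto_ae (fun n => (hφ n).memLp) (memLp_sobolevFun u) h1
  replace h1 := h1.comp hk.tendsto_atTop
  replace h2 := h2.comp hk.tendsto_atTop
  have mu := memLp_sobolevFun u
  have mg := memLp_sobolevGrad u
  have mFu : MemLp (fun x => F (sobolevFun u x)) 2 (volume.restrict Ω) := by
    refine mu.of_le_mul (c := L) (hF.continuous.comp_aestronglyMeasurable mu.1)
      (Eventually.of_forall fun x => ?_)
    simpa [h0] using hLip (sobolevFun u x) 0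
  have mGu : MemLp (fun x => deriv F (sobolevFun u x) • sobolevGrad u x) 2
      (volume.restrict Ω) := by
    refine mg.of_le_mul (c := L) ((hdc.comp_aestronglyMeasurable mu.1).smul mg.1)
      (Eventually.of_forall fun x => ?_)
    rw [norm_smul]
    exact mul_le_mul_of_nonneg_right (hL _) (norm_nonneg _)
  refine exists_of_tendsto (fun n => (hφ (k n)).comp_left hF h0) mFu mGu ?_ ?_
  · have hlim := h1.const_mul (L ^ 2)
    rw [mul_zero] at hlim
    refine squeeze_zero (fun n => integral_nonneg fun _ => by positivity) (fun n => ?_) hlim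
    simp only [Function.comp_apply]
    rw [← integral_const_mul]
    refine integral_mono (integrable_norm_sq (((hφ (k n)).comp_left hF h0).memLp.sub mFu))
      ((integrable_norm_sq ((hφ (k n)).memLp.sub mu)).const_mul _) fun x => ?_
    simp only [Real.norm_eq_abs]
    rw [← mul_pow]
    exact pow_le_pow_left₀ (abs_nonneg _) (hLip _ _) 2
  · have hdom := tendsto_integral_norm_sub_sq (μ := volume.restrict Ω)
      (f := fun n x => deriv F (φ (k n) x) • sobolevGrad u x)
      (g := fun x => deriv F (sobolevFun u x) • sobolevGrad u x)
      (B := fun x => L * ‖sobolevGrad u x‖)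
      (fun n => ((hdc.comp (hφ (k n)).1.continuous).aestronglyMeasurable).smul mg.1)
      (mg.norm.const_mul L) (fun n => Eventually.of_forall fun x => by
        rw [norm_smul]
        exact mul_le_mul_of_nonneg_right (hL _) (norm_nonneg _))
      (by
        filter_upwards [hae] with x hx
        exact ((hdc.tendsto _).comp hx).smul_const _)
    have hlim := ((h2.const_mul (2 * L ^ 2)).add (hdom.const_mul 2))
    rw [mul_zero, mul_zero, add_zero] at hlim
    have m1 : ∀ n, MemLp (fun x => deriv F (φ (k n) x) • sobolevGrad u x) 2
        (volume.restrict Ω) := fun n =>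
      mg.of_le_mul (c := L)
        (((hdc.comp (hφ (k n)).1.continuous).aestronglyMeasurable).smul mg.1)
        (Eventually.of_forall fun x => by
          rw [norm_smul]
          exact mul_le_mul_of_nonneg_right (hL _) (norm_nonneg _))
    refine squeeze_zero (fun n => integral_nonneg fun _ => by positivity) (fun n => ?_) hlim
    simp only [Function.comp_apply]
    have i1 := (integrable_norm_sq ((hφ (k n)).gradient_memLp.sub mg)).const_mul (2 * L ^ 2)
    have i2 := (integrable_norm_sq ((m1 n).sub mGu)).const_mul 2
    simp only [Pi.sub_apply] at i1 i2
    rw [← integral_const_mul, ← integral_const_mul, ← integral_add i1 i2]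
    refine integral_mono (integrable_norm_sq
      (((hφ (k n)).comp_left hF h0).gradient_memLp.sub mGu)) (i1.add i2) fun x => ?_
    rw [gradient_comp_left (hFd _) ((hφ (k n)).differentiable x)]
    set A := deriv F (φ (k n) x)
    -- The first summand is controlled by `L` and the convergence of the gradients, the second by
    -- `hdom`; the factors 2 in `hlim` come from `‖p + q‖² ≤ 2‖p‖² + 2‖q‖²`.
    have e : A • gradient (φ (k n)) x - deriv F (sobolevFun u x) • sobolevGrad u x =
        A • (gradient (φ (k n)) x - sobolevGrad u x) +
          (A • sobolevGrad u x - deriv F (sobolevFun u x) • sobolevGrad u x) := by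
      rw [smul_sub]; abel
    rw [e]
    set p := A • (gradient (φ (k n)) x - sobolevGrad u x) with hp
    set q := A • sobolevGrad u x - deriv F (sobolevFun u x) • sobolevGrad u x
    have hp' : ‖p‖ ^ 2 ≤ L ^ 2 * ‖gradient (φ (k n)) x - sobolevGrad u x‖ ^ 2 := by
      rw [hp, norm_smul, ← mul_pow]
      exact pow_le_pow_left₀ (by positivity)
        (mul_le_mul_of_nonneg_right (hL _) (norm_nonneg _)) 2
    have := norm_add_le p q
    nlinarith [norm_nonneg (p + q), norm_nonneg p, norm_nonneg q, sq_nonneg (‖p‖ - ‖q‖)]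

end ChainRule

/-! ### Rellich's theorem -/

section Rellich

variable {N : ℕ} {Ω : Set (EuclideanSpace ℝ (Fin N))}

/-- The variance of `f` on the unit interval is nonnegative. -/
lemma sq_intervalIntegral_le {f : ℝ → ℝ} (hf : Continuous f) :
    (∫ t in (0 : ℝ)..1, f t) ^ 2 ≤ ∫ t in (0 : ℝ)..1, f t ^ 2 := by
  set c := ∫ t in (0 : ℝ)..1, f t with hc
  have h : 0 ≤ ∫ t in (0 : ℝ)..1, (f t - c) ^ 2 :=
    intervalIntegral.integral_nonneg (by norm_num) fun _ _ => sq_nonneg _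
  have e : ∀ t, (f t - c) ^ 2 = (f t ^ 2 - 2 * c * f t) + c ^ 2 := fun t => by ring
  simp only [e] at h
  have i1 : IntervalIntegrable (fun t => f t ^ 2) volume 0 1 := (hf.pow 2).intervalIntegrable _ _
  have i2 : IntervalIntegrable (fun t => 2 * c * f t) volume 0 1 :=
    (continuous_const.mul hf).intervalIntegrable _ _
  rw [intervalIntegral.integral_add (i1.sub i2) intervalIntegrable_const,
    intervalIntegral.integral_sub i1 i2, intervalIntegral.integral_const_mul, ← hc] at h
  simp at h
  nlinarith

/-- The `L²` modulus of continuity of a test function is controlled by its gradient. -/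
lemma IsTestFunction.integral_translate_sub_sq_le {φ : EuclideanSpace ℝ (Fin N) → ℝ}
    (hφ : IsTestFunction Ω φ) (h : EuclideanSpace ℝ (Fin N)) :
    ∫ x, (φ (x + h) - φ x) ^ 2 ≤ ‖h‖ ^ 2 * ∫ x, ‖gradient φ x‖ ^ 2 := by
  have hgc := hφ.continuous_gradient
  have ig : Integrable (fun x => ‖gradient φ x‖ ^ 2) :=
    integrable_norm_sq (hgc.memLp_of_hasCompactSupport hφ.hasCompactSupport_gradient)
  have hJ : Integrable (fun p : EuclideanSpace ℝ (Fin N) × ℝ => ‖gradient φ (p.1 + p.2 • h)‖ ^ 2)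
      (volume.prod (volume.restrict (Ioc (0 : ℝ) 1))) := by
    rw [integrable_prod_iff' (by fun_prop)]
    refine ⟨Eventually.of_forall fun t => ig.comp_add_right (t • h), ?_⟩
    have : (fun t : ℝ => ∫ x, ‖‖gradient φ (x + t • h)‖ ^ 2‖) =
        fun _ => ∫ x, ‖gradient φ x‖ ^ 2 := by
      ext t
      simp only [norm_pow, norm_norm]
      exact integral_add_right_eq_self (fun x => ‖gradient φ x‖ ^ 2) (t • h)
    rw [this]
    exact integrable_const _
  -- Write the increment as the integral over `0 ≤ t ≤ 1` of `∇φ(x + t h) · h`, then apply Jensen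
  -- and Cauchy–Schwarz. Integrating in `x` removes the shift `t h` by translation invariance.
  have hpt : ∀ x, (φ (x + h) - φ x) ^ 2 ≤
      ‖h‖ ^ 2 * ∫ t in Ioc (0 : ℝ) 1, ‖gradient φ (x + t • h)‖ ^ 2 := fun x => by
    have hc : Continuous fun t : ℝ => ⟪gradient φ (x + t • h), h⟫_ℝ := by fun_prop
    have hd : ∀ t : ℝ, HasDerivAt (fun t : ℝ => φ (x + t • h)) ⟪gradient φ (x + t • h), h⟫_ℝ t := by
      intro t
      rw [inner_gradient]
      have h1 : HasDerivAt (fun t : ℝ => x + t • h) h t := by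
        simpa using ((hasDerivAt_id t).smul_const h).const_add x
      exact (hφ.differentiable _).hasFDerivAt.comp_hasDerivAt t h1
    have hF := intervalIntegral.integral_eq_sub_of_hasDerivAt (a := 0) (b := 1)
      (fun t _ => hd t) (hc.intervalIntegrable _ _)
    simp only [one_smul, zero_smul, add_zero] at hF
    rw [← hF, ← integral_const_mul, ← intervalIntegral.integral_of_le zero_le_one]
    refine (sq_intervalIntegral_le hc).trans (intervalIntegral.integral_mono_on zero_le_one
      ((hc.pow 2).intervalIntegrable _ _) (Continuous.intervalIntegrable (by fun_prop) _ _)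
      fun t _ => ?_)
    rw [← mul_pow, ← sq_abs, mul_comm]
    exact pow_le_pow_left₀ (abs_nonneg _) (abs_real_inner_le_norm _ _) 2
  have i0 : Integrable fun x => (φ (x + h) - φ x) ^ 2 := by
    refine Continuous.integrable_of_hasCompactSupport ?_ ?_
    · have := hφ.1.continuous
      fun_prop
    · exact HasCompactSupport.comp_left (g := fun s : ℝ => s ^ 2)
        ((hφ.2.1.comp_homeomorph (Homeomorph.addRight h)).sub hφ.2.1) (by simp)
  refine (integral_mono i0 (hJ.integral_prod_left.const_mul _) hpt).trans ?_
  rw [integral_const_mul]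
  refine mul_le_mul_of_nonneg_left (le_of_eq ?_) (by positivity)
  rw [integral_integral_swap hJ]
  have : ∀ t : ℝ, ∫ x, ‖gradient φ (x + t • h)‖ ^ 2 = ∫ x, ‖gradient φ x‖ ^ 2 := fun t =>
    integral_add_right_eq_self (fun x => ‖gradient φ x‖ ^ 2) (t • h)
  simp [this]

lemma setIntegral_ball_eq {φ : EuclideanSpace ℝ (Fin N) → ℝ} (r : ℝ)
    (x : EuclideanSpace ℝ (Fin N)) : ∫ y in Metric.ball x r, φ y =
      ∫ h in Metric.ball (0 : EuclideanSpace ℝ (Fin N)) r, φ (x + h) := by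
  rw [← (measurePreserving_add_left volume x).setIntegral_preimage_emb
    (measurableEmbedding_addLeft x) φ (Metric.ball x r)]
  congr 2
  ext y
  simp

lemma stronglyMeasurable_setIntegral_ball {φ : EuclideanSpace ℝ (Fin N) → ℝ} (hφ : Continuous φ)
    (r : ℝ) : StronglyMeasurable fun x => ∫ y in Metric.ball x r, φ y := by
  rw [funext (setIntegral_ball_eq r)]
  exact StronglyMeasurable.integral_prod_right
    (f := fun x h : EuclideanSpace ℝ (Fin N) => φ (x + h))
    (Continuous.stronglyMeasurable (by unfold Function.uncurry; fun_prop))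

/-- The `L²` norm of a test function is controlled by its gradient and its averages on balls. -/
lemma IsTestFunction.integral_sq_le {φ : EuclideanSpace ℝ (Fin N) → ℝ}
    (hφ : IsTestFunction Ω φ) (hb : Bornology.IsBounded Ω) {r : ℝ} (hr : 0 < r) :
    ∫ x in Ω, φ x ^ 2 ≤ r ^ 2 * (∫ x in Ω, ‖gradient φ x‖ ^ 2) +
      ((volume (Metric.ball (0 : EuclideanSpace ℝ (Fin N)) r)).toReal ^ 2)⁻¹ *
        ∫ x in Ω, (∫ y in Metric.ball x r, φ y) ^ 2 := by
  set B := Metric.ball (0 : EuclideanSpace ℝ (Fin N)) r with hB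
  have hφc := hφ.1.continuous
  have hΩf : IsFiniteMeasure (volume.restrict Ω) :=
    ⟨by simpa using hb.measure_lt_top⟩
  have hBf : IsFiniteMeasure (volume.restrict B) :=
    ⟨by simpa using measure_ball_lt_top⟩
  set V := (volume B).toReal with hV
  have hVpos : 0 < V := ENNReal.toReal_pos (Metric.measure_ball_pos _ _ hr).ne'
    measure_ball_lt_top.ne
  obtain ⟨C, hC⟩ := hφc.bounded_above_of_compact_support hφ.2.1
  have hC0 : 0 ≤ C := (norm_nonneg _).trans (hC 0)
  set D := ∫ x in Ω, ‖gradient φ x‖ ^ 2 with hD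
  set S := ∫ x in Ω, φ x ^ 2 with hS
  have hD' : D = ∫ x, ‖gradient φ x‖ ^ 2 :=
    setIntegral_eq_integral_of_forall_compl_eq_zero fun x hx => by simp [hφ.gradient_eq_zero hx]
  have hS' : S = ∫ x, φ x ^ 2 :=
    setIntegral_eq_integral_of_forall_compl_eq_zero fun x hx => by simp [hφ.eq_zero hx]
  have is : Integrable fun x => φ x ^ 2 := (hφc.memLp_of_hasCompactSupport hφ.2.1).integrable_sq
  have hK : Integrable (fun p : EuclideanSpace ℝ (Fin N) × EuclideanSpace ℝ (Fin N) =>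
      φ p.1 * φ (p.1 + p.2)) ((volume.restrict Ω).prod (volume.restrict B)) := by
    refine Integrable.of_bound (C := C * C) (by fun_prop) (Eventually.of_forall fun p => ?_)
    rw [norm_mul]
    exact mul_le_mul (hC _) (hC _) (norm_nonneg _) hC0
  -- Expanding the square in the translation estimate bounds the correlation `∫ φ(x) φ(x + h)` from
  -- below; averaging over `h ∈ B` turns it into `∫ φ I`, with `I x` the integral of `φ` over the
  -- ball at `x`.
  have hh : ∀ h ∈ B, 2 * S - r ^ 2 * D ≤ 2 * ∫ x in Ω, φ x * φ (x + h) := fun h hh => by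
    have h1 := hφ.integral_translate_sub_sq_le h
    have e : ∀ x, (φ (x + h) - φ x) ^ 2 = (φ (x + h) ^ 2 + φ x ^ 2) - 2 * (φ x * φ (x + h)) :=
      fun x => by ring
    have is' : Integrable fun x => φ (x + h) ^ 2 := is.comp_add_right h
    have im : Integrable fun x => φ x * φ (x + h) :=
      Continuous.integrable_of_hasCompactSupport (by fun_prop) hφ.2.1.mul_right
    have is2 : Integrable fun x => φ (x + h) ^ 2 + φ x ^ 2 := is'.add is
    simp only [e] at h1
    rw [integral_sub is2 (im.const_mul 2), integral_add is' is, integral_const_mul,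
      integral_add_right_eq_self (fun x => φ x ^ 2) h, ← hS', ← hD',
      ← setIntegral_eq_integral_of_forall_compl_eq_zero (s := Ω)
        (fun x hx => by simp [hφ.eq_zero hx])] at h1
    have hhr : ‖h‖ ^ 2 ≤ r ^ 2 :=
      pow_le_pow_left₀ (norm_nonneg _) (mem_ball_zero_iff.1 hh).le 2
    have hD0 : 0 ≤ D := integral_nonneg fun _ => by positivity
    nlinarith [mul_le_mul_of_nonneg_right hhr hD0]
  have h2 := setIntegral_mono_on (μ := volume) (s := B) integrableOn_const
    (hK.integral_prod_right.const_mul 2) measurableSet_ball hh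
  set I := fun x => ∫ y in Metric.ball x r, φ y with hI
  have hIe : ∀ x, I x = ∫ h in B, φ (x + h) := setIntegral_ball_eq r
  have havg : ∀ x, ∫ h in B, φ x * φ (x + h) = φ x * I x := fun x => by
    rw [integral_const_mul, hIe]
  rw [setIntegral_const, integral_const_mul, ← integral_integral_swap hK] at h2
  simp only [havg] at h2
  have iK : Integrable (fun x => φ x * I x) (volume.restrict Ω) := by
    simpa only [havg] using hK.integral_prod_left
  have hIm : AEStronglyMeasurable I (volume.restrict Ω) :=
    (stronglyMeasurable_setIntegral_ball hφc r).aestronglyMeasurable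
  have hIb : ∀ x, ‖I x‖ ≤ C * V := fun x => by
    rw [hIe]
    exact norm_setIntegral_le_of_norm_le_const measure_ball_lt_top fun _ _ => hC _
  have iI : Integrable (fun x => I x ^ 2) (volume.restrict Ω) :=
    (MemLp.of_bound hIm (C * V) (Eventually.of_forall hIb)).integrable_sq
  -- Young's inequality `2 V φ I ≤ V² φ² + I²`: half of the `2 V² S` obtained from `h2` is absorbed
  -- and one copy of `V² S` remains.
  have h3 : 2 * V * ∫ x in Ω, φ x * I x ≤ V ^ 2 * S + ∫ x in Ω, I x ^ 2 := by
    rw [← integral_const_mul, ← integral_const_mul, ← integral_add (is.restrict.const_mul _) iI]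
    refine integral_mono (iK.const_mul _) ((is.restrict.const_mul _).add iI) fun x => ?_
    nlinarith [sq_nonneg (V * φ x - I x)]
  have h4 : volume.real B = V := rfl
  rw [h4, smul_eq_mul] at h2
  rw [← sub_le_iff_le_add', ← div_eq_inv_mul, le_div_iff₀ (by positivity)]
  nlinarith

lemma IsTestFunction.norm_toH1_sq {φ : EuclideanSpace ℝ (Fin N) → ℝ} (hφ : IsTestFunction Ω φ) :
    ‖hφ.toH1‖ ^ 2 = (∫ x in Ω, φ x ^ 2) + ∫ x in Ω, ‖gradient φ x‖ ^ 2 := by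
  rw [← real_inner_self_eq_norm_sq]
  refine (L2Pair.inner_eq hφ.memLp.coeFn_toLp hφ.memLp.coeFn_toLp
    hφ.gradient_memLp.coeFn_toLp hφ.gradient_memLp.coeFn_toLp).trans ?_
  simp only [real_inner_self_eq_norm_sq, ← pow_two]

lemma IsTestFunction.integrable_sq {φ : EuclideanSpace ℝ (Fin N) → ℝ} (hφ : IsTestFunction Ω φ) :
    Integrable fun x => φ x ^ 2 :=
  (hφ.1.continuous.memLp_of_hasCompactSupport hφ.2.1).integrable_sq

/-- From `|φ| ≤ φ² + 1`. The bound is uniform in `x` and depends on `φ` only through its `L²` norm,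
so it serves as a constant majorant for the ball integrals of a bounded sequence. -/
lemma IsTestFunction.norm_setIntegral_ball_le {φ : EuclideanSpace ℝ (Fin N) → ℝ}
    (hφ : IsTestFunction Ω φ) (r : ℝ) (x : EuclideanSpace ℝ (Fin N)) :
    ‖∫ y in Metric.ball x r, φ y‖ ≤ (∫ y in Ω, φ y ^ 2) +
      (volume (Metric.ball (0 : EuclideanSpace ℝ (Fin N)) r)).toReal := by
  have i1 : Integrable (fun y => φ y ^ 2 + 1) (volume.restrict (Metric.ball x r)) :=
    hφ.integrable_sq.restrict.add (integrableOn_const measure_ball_lt_top.ne)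
  calc ‖∫ y in Metric.ball x r, φ y‖ ≤ ∫ y in Metric.ball x r, (φ y ^ 2 + 1) := by
        refine norm_integral_le_of_norm_le i1 (Eventually.of_forall fun y => ?_)
        rw [Real.norm_eq_abs, ← sq_abs]
        nlinarith [sq_nonneg (|φ y| - 1)]
    _ = (∫ y in Metric.ball x r, φ y ^ 2) + volume.real (Metric.ball x r) := by
        rw [integral_add hφ.integrable_sq.restrict (integrableOn_const measure_ball_lt_top.ne)]
        simp
    _ ≤ _ := by
        refine add_le_add ?_ (le_of_eq ?_)
        · rw [setIntegral_eq_integral_of_forall_compl_eq_zero (s := Ω)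
            fun x hx => by simp [hφ.eq_zero hx]]
          exact setIntegral_le_integral hφ.integrable_sq (Eventually.of_forall fun y => sq_nonneg _)
        · rw [Measure.real, Measure.addHaar_ball_center]

/-- A ball integral is the pairing with `(1_B, 0)`, which lies in the product space because `Ω` has
finite measure. -/
lemma tendsto_setIntegral_ball {φ : ℕ → EuclideanSpace ℝ (Fin N) → ℝ} (hb : Bornology.IsBounded Ω)
    (hφ : ∀ n, IsTestFunction Ω (φ n))
    (hw : ∀ y : L2Pair Ω, Tendsto (fun n => ⟪((hφ n).toH1 : L2Pair Ω), y⟫_ℝ) atTop (𝓝 0))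
    (r : ℝ) (x : EuclideanSpace ℝ (Fin N)) :
    Tendsto (fun n => ∫ y in Metric.ball x r, φ n y) atTop (𝓝 0) := by
  have hΩf : IsFiniteMeasure (volume.restrict Ω) := ⟨by simpa using hb.measure_lt_top⟩
  have hm : MemLp ((Metric.ball x r).indicator fun _ => (1 : ℝ)) 2 (volume.restrict Ω) :=
    (memLp_const 1).indicator measurableSet_ball
  refine (hw (WithLp.toLp 2 (hm.toLp _, 0))).congr fun n => ?_
  refine (L2Pair.inner_eq (hφ n).memLp.coeFn_toLp hm.coeFn_toLp
    (hφ n).gradient_memLp.coeFn_toLp (Lp.coeFn_zero _ _ _)).trans ?_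
  simp only [Pi.zero_apply, inner_zero_right, integral_zero, add_zero]
  rw [setIntegral_eq_integral_of_forall_compl_eq_zero
    fun x hx => by simp [(hφ n).eq_zero hx], ← integral_indicator measurableSet_ball]
  congr 1
  ext y
  by_cases hy : y ∈ Metric.ball x r <;> simp [indicator, hy]

/-- Rellich's theorem for test functions. -/
lemma tendsto_integral_sq_of_isTestFunction {φ : ℕ → EuclideanSpace ℝ (Fin N) → ℝ}
    (hb : Bornology.IsBounded Ω) (hφ : ∀ n, IsTestFunction Ω (φ n)) {K : ℝ} (hK : 0 < K)
    (hS : ∀ n, ∫ x in Ω, φ n x ^ 2 ≤ K) (hD : ∀ n, ∫ x in Ω, ‖gradient (φ n) x‖ ^ 2 ≤ K)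
    (hI : ∀ r x, Tendsto (fun n => ∫ y in Metric.ball x r, φ n y) atTop (𝓝 0)) :
    Tendsto (fun n => ∫ x in Ω, φ n x ^ 2) atTop (𝓝 0) := by
  have hΩf : IsFiniteMeasure (volume.restrict Ω) := ⟨by simpa using hb.measure_lt_top⟩
  rw [Metric.tendsto_atTop]
  intro ε hε
  -- The radius is fixed first, making the gradient term at most `ε / 2` for all `n`; only then does
  -- `n` grow to make the ball integrals small.
  obtain ⟨r, hr, hrε⟩ : ∃ r : ℝ, 0 < r ∧ r ^ 2 * K ≤ ε / 2 := by
    refine ⟨Real.sqrt (ε / 2 / K), by positivity, ?_⟩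
    rw [Real.sq_sqrt (by positivity), div_mul_cancel₀ _ hK.ne']
  have h0 := tendsto_integral_norm_sub_sq (μ := volume.restrict Ω)
    (f := fun n x => ∫ y in Metric.ball x r, φ n y) (g := fun _ => 0)
    (B := fun _ => K + (volume (Metric.ball (0 : EuclideanSpace ℝ (Fin N)) r)).toReal)
    (fun n => (stronglyMeasurable_setIntegral_ball (hφ n).1.continuous r).aestronglyMeasurable)
    (memLp_const _) (fun n => Eventually.of_forall fun x =>
      ((hφ n).norm_setIntegral_ball_le r x).trans (add_le_add_left (hS n) _))
    (Eventually.of_forall fun x => hI r x)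
  simp only [sub_zero, Real.norm_eq_abs, sq_abs] at h0
  have h1 := h0.const_mul
    ((volume (Metric.ball (0 : EuclideanSpace ℝ (Fin N)) r)).toReal ^ 2)⁻¹
  rw [mul_zero] at h1
  obtain ⟨n₀, h2⟩ := (h1.eventually_lt_const (half_pos hε)).exists_forall_of_atTop
  refine ⟨n₀, fun n hn => ?_⟩
  rw [Real.dist_0_eq_abs, abs_of_nonneg (integral_nonneg fun _ => sq_nonneg _)]
  have h3 := (hφ n).integral_sq_le hb hr
  have h6 := mul_le_mul_of_nonneg_left (hD n) (sq_nonneg r)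
  linarith [h2 n hn]

/-- Rellich's theorem: weak null sequences of `H₀¹(Ω)` are null sequences of `L²(Ω)`. -/
lemma tendsto_integral_sobolevFun_sq (hΩ : IsOpen Ω) (hb : Bornology.IsBounded Ω)
    {w : ℕ → H01 Ω} {C : ℝ} (hC : ∀ n, ‖w n‖ ≤ C)
    (hw : ∀ y : L2Pair Ω, Tendsto (fun n => ⟪((w n : H1 Ω) : L2Pair Ω), y⟫_ℝ) atTop (𝓝 0)) :
    Tendsto (fun n => ∫ x in Ω, ‖sobolevFun (w n) x‖ ^ 2) atTop (𝓝 0) := by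
  -- Approximation within `1 / (n + 1)` preserves weak convergence to zero and costs at most 1 in
  -- the norm bound.
  choose φ hφ hlt using fun n : ℕ => exists_isTestFunction_norm_sub_lt hΩ (w n)
    (ε := 1 / ((n : ℝ) + 1)) (by positivity)
  have hd : Tendsto (fun n => ‖(w n : H1 Ω) - (hφ n).toH1‖) atTop (𝓝 0) :=
    squeeze_zero (fun _ => norm_nonneg _) (fun n => (hlt n).le)
      tendsto_one_div_add_atTop_nhds_zero_nat
  have hC0 : 0 ≤ C := (norm_nonneg _).trans (hC 0)
  have hbd : ∀ n, (∫ x in Ω, φ n x ^ 2) + ∫ x in Ω, ‖gradient (φ n) x‖ ^ 2 ≤ (C + 1) ^ 2 :=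
    fun n => by
    rw [← (hφ n).norm_toH1_sq]
    refine pow_le_pow_left₀ (norm_nonneg _) ?_ 2
    have h1 := norm_sub_norm_le (hφ n).toH1 (w n : H1 Ω)
    rw [norm_sub_rev] at h1
    have h2 : ‖(w n : H1 Ω)‖ ≤ C := hC n
    have h3 : 1 / ((n : ℝ) + 1) ≤ 1 := by
      rw [div_le_one (by positivity)]
      linarith [(Nat.cast_nonneg n : (0 : ℝ) ≤ n)]
    linarith [hlt n]
  have hweak : ∀ y : L2Pair Ω,
      Tendsto (fun n => ⟪((hφ n).toH1 : L2Pair Ω), y⟫_ℝ) atTop (𝓝 0) := fun y => by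
    have h1 : Tendsto (fun n => ⟪((w n : H1 Ω) : L2Pair Ω) - (hφ n).toH1, y⟫_ℝ) atTop (𝓝 0) := by
      have := hd.mul_const ‖y‖
      rw [zero_mul] at this
      exact squeeze_zero_norm (fun n => norm_inner_le_norm _ _) this
    have := (hw y).sub h1
    simp only [inner_sub_left, sub_sub_cancel, sub_zero] at this
    exact this
  have hφ0 := tendsto_integral_sq_of_isTestFunction hb hφ (K := (C + 1) ^ 2) (by positivity)
    (fun n => le_trans (le_add_of_nonneg_right (integral_nonneg fun _ => sq_nonneg _)) (hbd n))
    (fun n => le_trans (le_add_of_nonneg_left (integral_nonneg fun _ => sq_nonneg _)) (hbd n))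
    (tendsto_setIntegral_ball hb hφ hweak)
  have hlim := ((hd.pow 2).const_mul 2).add (hφ0.const_mul 2)
  rw [zero_pow two_ne_zero, mul_zero, add_zero] at hlim
  refine squeeze_zero (fun n => integral_nonneg fun _ => by positivity) (fun n => ?_) hlim
  have i1 := integrable_norm_sq ((memLp_sobolevFun (w n)).sub (hφ n).memLp)
  simp only [Pi.sub_apply] at i1
  have i2 : Integrable (fun x => φ n x ^ 2) (volume.restrict Ω) := (hφ n).integrable_sq.restrict
  have h1 : ∫ x in Ω, ‖sobolevFun (w n) x‖ ^ 2 ≤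
      2 * (∫ x in Ω, ‖sobolevFun (w n) x - φ n x‖ ^ 2) + 2 * ∫ x in Ω, φ n x ^ 2 := by
    rw [← integral_const_mul, ← integral_const_mul,
      ← integral_add (i1.const_mul 2) (i2.const_mul 2)]
    refine integral_mono (integrable_norm_sq (memLp_sobolevFun (w n)))
      ((i1.const_mul 2).add (i2.const_mul 2)) fun x => ?_
    simp only [Real.norm_eq_abs, sq_abs]
    nlinarith [sq_nonneg (sobolevFun (w n) x - 2 * φ n x)]
  have h2 := norm_sub_toH1_sq (hφ n) (w n)
  have h3 : 0 ≤ ∫ x in Ω, ‖sobolevGrad (w n) x - gradient (φ n) x‖ ^ 2 :=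
    integral_nonneg fun _ => by positivity
  linarith

end Rellich

/-! ### Convergence of `L²` pairings -/

section L2

variable {α : Type*} {m : MeasurableSpace α} {μ : Measure α}
variable {F : Type*} [NormedAddCommGroup F] [InnerProductSpace ℝ F]

/-- Pairing a strongly convergent sequence of `L²` with a bounded sequence. -/
lemma tendsto_integral_inner {f g : ℕ → α → F} {f₀ : α → F} {C l : ℝ}
    (hf : ∀ n, MemLp (f n) 2 μ) (hf₀ : MemLp f₀ 2 μ) (hg : ∀ n, MemLp (g n) 2 μ)
    (h : Tendsto (fun n => ∫ x, ‖f n x - f₀ x‖ ^ 2 ∂μ) atTop (𝓝 0))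
    (hC : ∀ n, ∫ x, ‖g n x‖ ^ 2 ∂μ ≤ C)
    (hl : Tendsto (fun n => ∫ x, ⟪f₀ x, g n x⟫_ℝ ∂μ) atTop (𝓝 l)) :
    Tendsto (fun n => ∫ x, ⟪f n x, g n x⟫_ℝ ∂μ) atTop (𝓝 l) := by
  -- Cauchy–Schwarz: `g n` is bounded in `L²` and `f n - f₀` tends to zero there.
  have h1 : Tendsto (fun n => ∫ x, ⟪f n x - f₀ x, g n x⟫_ℝ ∂μ) atTop (𝓝 0) := by
    have h2 := (h.sqrt).mul_const (Real.sqrt C)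
    rw [Real.sqrt_zero, zero_mul] at h2
    refine squeeze_zero_norm (fun n => ?_) h2
    have e1 := inner_eq_integral ((hf n).sub hf₀).coeFn_toLp (hg n).coeFn_toLp
    simp only [Pi.sub_apply] at e1
    rw [← e1]
    refine (norm_inner_le_norm _ _).trans
      (mul_le_mul (Real.le_sqrt_of_sq_le (le_of_eq ?_)) (Real.le_sqrt_of_sq_le ?_)
      (norm_nonneg _) (Real.sqrt_nonneg _))
    · rw [MemLp.toLp_sub (hf n) hf₀]
      exact norm_sub_sq_eq_integral (hf n).coeFn_toLp hf₀.coeFn_toLp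
    · refine le_of_eq_of_le ?_ (hC n)
      rw [Lp_norm_sq_eq_integral]
      refine integral_congr_ae ?_
      filter_upwards [(hg n).coeFn_toLp] with x hx
      rw [hx]
  have h3 := h1.add hl
  rw [zero_add] at h3
  refine h3.congr fun n => ?_
  have i1 := integrable_inner_of_memLp ((hf n).sub hf₀) (hg n)
  simp only [Pi.sub_apply] at i1
  rw [← integral_add i1 (integrable_inner_of_memLp hf₀ (hg n))]
  simp only [inner_sub_left, sub_add_cancel]

lemma integral_norm_sq_le {V : Type*} [NormedAddCommGroup V] {f g : α → V}
    (hf : MemLp f 2 μ) (hg : MemLp g 2 μ) :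
    ∫ x, ‖f x‖ ^ 2 ∂μ ≤ 2 * (∫ x, ‖f x - g x‖ ^ 2 ∂μ) + 2 * ∫ x, ‖g x‖ ^ 2 ∂μ := by
  have i1 := integrable_norm_sq (hf.sub hg)
  simp only [Pi.sub_apply] at i1
  have i2 := integrable_norm_sq hg
  rw [← integral_const_mul, ← integral_const_mul,
    ← integral_add (i1.const_mul 2) (i2.const_mul 2)]
  refine integral_mono (integrable_norm_sq hf) ((i1.const_mul 2).add (i2.const_mul 2)) fun x => ?_
  have h := norm_add_le (f x - g x) (g x)
  rw [sub_add_cancel] at h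
  change ‖f x‖ ^ 2 ≤ 2 * ‖f x - g x‖ ^ 2 + 2 * ‖g x‖ ^ 2
  nlinarith [norm_nonneg (f x), norm_nonneg (f x - g x), norm_nonneg (g x),
    sq_nonneg (‖f x - g x‖ - ‖g x‖)]

/-- The `L²` pairing is continuous. -/
lemma tendsto_integral_inner_of_tendsto {f g : ℕ → α → F} {f₀ g₀ : α → F}
    (hf : ∀ n, MemLp (f n) 2 μ) (hf₀ : MemLp f₀ 2 μ) (hg : ∀ n, MemLp (g n) 2 μ)
    (hg₀ : MemLp g₀ 2 μ)
    (h : Tendsto (fun n => ∫ x, ‖f n x - f₀ x‖ ^ 2 ∂μ) atTop (𝓝 0))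
    (h' : Tendsto (fun n => ∫ x, ‖g n x - g₀ x‖ ^ 2 ∂μ) atTop (𝓝 0)) :
    Tendsto (fun n => ∫ x, ⟪f n x, g n x⟫_ℝ ∂μ) atTop (𝓝 (∫ x, ⟪f₀ x, g₀ x⟫_ℝ ∂μ)) := by
  obtain ⟨C, hC⟩ := h'.bddAbove_range
  refine tendsto_integral_inner (C := 2 * C + 2 * ∫ x, ‖g₀ x‖ ^ 2 ∂μ) hf hf₀ hg h (fun n => ?_) ?_
  · have h1 : ∫ x, ‖g n x - g₀ x‖ ^ 2 ∂μ ≤ C := hC (mem_range_self n)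
    have h2 := integral_norm_sq_le (hg n) hg₀
    linarith
  -- The remaining limit with `f₀` fixed is the same lemma with the two arguments exchanged.
  · simp only [fun n x => real_inner_comm (g n x) (f₀ x), fun x => real_inner_comm (g₀ x) (f₀ x)]
    exact tendsto_integral_inner (C := ∫ x, ‖f₀ x‖ ^ 2 ∂μ) hg hg₀ (fun _ => hf₀) h'
      (fun _ => le_rfl) tendsto_const_nhds

end L2

/-! ### The nonlinear test function and the coefficient `a(x, u)` -/

section Auxiliary

/-- A bounded smooth function with bounded derivative which dominates quadratic gradient terms. -/
lemma exists_smooth_dominating (b R : ℝ) (hb : 0 ≤ b) (hR : 0 ≤ R) :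
    ∃ (F : ℝ → ℝ) (B L : ℝ), ContDiff ℝ ∞ F ∧ F 0 = 0 ∧ (∀ s, |F s| ≤ B) ∧
      (∀ s, |deriv F s| ≤ L) ∧ ∀ s, |s| ≤ R → 1 / 2 + 2 * b * |F s| ≤ deriv F s := by
  -- For `F = sinh(k s) / k` one has `F' = cosh(k s)`, and `k ≥ 4 b` gives `2 b |F| ≤ |sinh(k s)| /
  -- 2 ≤ cosh(k s) / 2`; the other half of `cosh` covers the constant `1/2`. The `+ 1` keeps `k`
  -- positive when `b = 0`.
  set k := 4 * b + 1 with hk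
  have hkpos : 0 < k := by positivity
  -- The cutoff makes `F` and `F'` bounded on the line. It equals 1 beyond radius `R`, so the
  -- derivative is that of the uncut function at every `|s| ≤ R`, endpoints included.
  let χ : ContDiffBump (0 : ℝ) := ⟨R + 1, R + 2, by positivity, by linarith⟩
  set F : ℝ → ℝ := fun s => χ s * (Real.sinh (k * s) / k) with hF
  have hFs : ContDiff ℝ ∞ F := by
    refine χ.contDiff.mul (ContDiff.div_const ?_ k)
    exact Real.contDiff_sinh.comp (contDiff_const.mul contDiff_id)
  have hFc : HasCompactSupport F := χ.hasCompactSupport.mul_right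
  obtain ⟨B, hB⟩ := hFs.continuous.bounded_above_of_compact_support hFc
  obtain ⟨L, hL⟩ := (hFs.continuous_deriv (by simp)).bounded_above_of_compact_support
    hFc.deriv
  refine ⟨F, B, L, hFs, by simp [hF], hB, hL, fun s hs => ?_⟩
  have heq : F =ᶠ[𝓝 s] fun s => Real.sinh (k * s) / k := by
    have : Metric.ball (0 : ℝ) (R + 1) ∈ 𝓝 s :=
      Metric.isOpen_ball.mem_nhds (by simpa using lt_of_le_of_lt hs (by linarith))
    filter_upwards [this] with t ht
    rw [hF]
    simp only
    rw [χ.one_of_mem_closedBall (Metric.ball_subset_closedBall ht), one_mul]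
  have hd : deriv F s = Real.cosh (k * s) := by
    rw [heq.deriv_eq]
    have h1 : HasDerivAt (fun s => Real.sinh (k * s) / k) (Real.cosh (k * s) * k / k) s :=
      (((hasDerivAt_id s).const_mul k).sinh.congr_deriv (by simp)).div_const k
    rw [h1.deriv, mul_div_cancel_right₀ _ hkpos.ne']
  rw [hd, heq.self_of_nhds, abs_div, abs_of_pos hkpos]
  have h1 : |Real.sinh (k * s)| ≤ Real.cosh (k * s) := 
    abs_le.2 ⟨by linarith [Real.cosh_add_sinh (k * s), Real.exp_pos (k * s)],
      (Real.sinh_lt_cosh _).le⟩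
  have h2 := Real.one_le_cosh (k * s)
  have h3 : 2 * b * (|Real.sinh (k * s)| / k) ≤ 1 / 2 * |Real.sinh (k * s)| := by
    rw [← mul_div_assoc, div_le_iff₀ hkpos]
    nlinarith [abs_nonneg (Real.sinh (k * s))]
  linarith

variable {N : ℕ} {Ω : Set (EuclideanSpace ℝ (Fin N))} {a : EuclideanSpace ℝ (Fin N) → ℝ → ℝ}

/-- Continuity of `a` is given only on `closure Ω ×ˢ univ`; extension by zero makes it a Borel
function, which can be composed with `x ↦ (x, u x)`. -/
lemma aestronglyMeasurable_coefficient (hΩ : IsOpen Ω)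
    (ha : ContinuousOn (fun p : EuclideanSpace ℝ (Fin N) × ℝ => a p.1 p.2) (closure Ω ×ˢ univ))
    {u : EuclideanSpace ℝ (Fin N) → ℝ} (hu : AEStronglyMeasurable u (volume.restrict Ω)) :
    AEStronglyMeasurable (fun x => a x (u x)) (volume.restrict Ω) := by
  have hm : MeasurableSet (closure Ω ×ˢ (univ : Set ℝ)) :=
    isClosed_closure.measurableSet.prod MeasurableSet.univ
  have h1 : Measurable ((closure Ω ×ˢ univ).indicator
      fun p : EuclideanSpace ℝ (Fin N) × ℝ => a p.1 p.2) := by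
    classical
    rw [← piecewise_eq_indicator]
    exact ha.measurable_piecewise continuousOn_const hm
  have h2 := (h1.comp_aemeasurable (aemeasurable_id.prodMk hu.aemeasurable)).aestronglyMeasurable
  refine h2.congr ?_
  filter_upwards [ae_restrict_mem hΩ.measurableSet] with x hx
  simp [indicator, subset_closure hx]

lemma exists_coefficient_bound (hb : Bornology.IsBounded Ω)
    (ha : ContinuousOn (fun p : EuclideanSpace ℝ (Fin N) × ℝ => a p.1 p.2) (closure Ω ×ˢ univ))
    (M : ℝ) : ∃ A, 0 ≤ A ∧ ∀ x ∈ Ω, ∀ s, |s| ≤ M → |a x s| ≤ A := by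
  obtain ⟨A, hA⟩ := (hb.isCompact_closure.prod (isCompact_Icc (a := -M) (b := M)))
    |>.exists_bound_of_continuousOn (ha.mono (prod_mono Subset.rfl (subset_univ _)))
  exact ⟨max A 0, le_max_right _ _, fun x hx s hs => le_max_of_le_left
    (hA (x, s) ⟨subset_closure hx, abs_le.1 hs⟩)⟩

lemma tendsto_coefficient
    (ha : ContinuousOn (fun p : EuclideanSpace ℝ (Fin N) × ℝ => a p.1 p.2) (closure Ω ×ˢ univ))
    {x : EuclideanSpace ℝ (Fin N)} (hx : x ∈ Ω) {s : ℕ → ℝ} {t : ℝ} (h : Tendsto s atTop (𝓝 t)) :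
    Tendsto (fun n => a x (s n)) atTop (𝓝 (a x t)) := by
  have hc : Continuous fun s => a x s := by
    have := ha.comp_continuous (f := fun s : ℝ => (x, s)) (by fun_prop)
      fun s => ⟨subset_closure hx, mem_univ s⟩
    exact this
  exact (hc.tendsto t).comp h

end Auxiliary

/-! ### The energy estimate -/

section Energy

lemma memLp_smul_of_bound {α : Type*} {m : MeasurableSpace α} {μ : Measure α} {E : Type*}
    [NormedAddCommGroup E] [NormedSpace ℝ E] {c : α → ℝ} {f : α → E} {C : ℝ}
    (hc : AEStronglyMeasurable c μ) (hC : ∀ᵐ x ∂μ, ‖c x‖ ≤ C) (hf : MemLp f 2 μ) :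
    MemLp (fun x => c x • f x) 2 μ := by
  refine hf.of_le_mul (c := C) (hc.smul hf.1) ?_
  filter_upwards [hC] with x h1
  rw [norm_smul]
  exact mul_le_mul_of_nonneg_right h1 (norm_nonneg _)

/-- Absorbing the quadratic term of the right-hand side into the left-hand side. -/
lemma half_integral_norm_sub_sq_le {α : Type*} {m : MeasurableSpace α} {μ : Measure α} {E : Type*}
    [NormedAddCommGroup E] [InnerProductSpace ℝ E] {p q : α → E} {c f a₂ : α → ℝ} {b C B : ℝ}
    (hp : MemLp p 2 μ) (hq : MemLp q 2 μ) (ha₂ : Integrable a₂ μ) (hb : 0 ≤ b)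
    (hcm : AEStronglyMeasurable c μ) (hcC : ∀ᵐ x ∂μ, ‖c x‖ ≤ C)
    (hfm : AEStronglyMeasurable f μ) (hfB : ∀ᵐ x ∂μ, ‖f x‖ ≤ B) (hf : ∀ x, 0 ≤ f x)
    (hcf : ∀ᵐ x ∂μ, 1 / 2 + 2 * b * f x ≤ c x)
    (h : ∫ x, ⟪c x • p x, p x - q x⟫_ℝ ∂μ ≤ ∫ x, (a₂ x + b * ‖p x‖ ^ 2) * f x ∂μ) :
    1 / 2 * (∫ x, ‖p x - q x‖ ^ 2 ∂μ) ≤ (∫ x, |a₂ x| * f x ∂μ) +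
      2 * b * (∫ x, ‖q x‖ ^ 2 * f x ∂μ) - ∫ x, ⟪c x • q x, p x - q x⟫_ℝ ∂μ := by
  have T1 := integrable_inner_of_memLp (memLp_smul_of_bound hcm hcC hp) (hp.sub hq)
  have T5 := integrable_inner_of_memLp (memLp_smul_of_bound hcm hcC hq) (hp.sub hq)
  have T2 : Integrable (fun x => (a₂ x + b * ‖p x‖ ^ 2) * f x) μ :=
    (ha₂.add ((integrable_norm_sq hp).const_mul b)).mul_bdd hfm hfB
  have T3 : Integrable (fun x => |a₂ x| * f x) μ := ha₂.abs.mul_bdd hfm hfB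
  have T4 : Integrable (fun x => ‖q x‖ ^ 2 * f x) μ :=
    (integrable_norm_sq hq).mul_bdd hfm hfB
  have T0 := integrable_norm_sq (hp.sub hq)
  simp only [Pi.sub_apply] at T1 T5 T0
  -- Split `⟪c p, p - q⟫ = ⟪c q, p - q⟫ + c ‖p - q‖²` and use `‖p‖² ≤ 2‖p - q‖² + 2‖q‖²`. The
  -- hypothesis `c ≥ 1/2 + 2 b f` is exactly what pays for `2 b f ‖p - q‖²` and still leaves `1/2 ‖p
  -- - q‖²`.
  have hpt : ∀ᵐ x ∂μ, 1 / 2 * ‖p x - q x‖ ^ 2 +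
      (⟪c x • q x, p x - q x⟫_ℝ + (a₂ x + b * ‖p x‖ ^ 2) * f x) ≤
      ⟪c x • p x, p x - q x⟫_ℝ + (|a₂ x| * f x + 2 * b * (‖q x‖ ^ 2 * f x)) := by
    filter_upwards [hcf] with x hcx
    have e : ⟪c x • p x, p x - q x⟫_ℝ = ⟪c x • q x, p x - q x⟫_ℝ + c x * ‖p x - q x‖ ^ 2 := by
      rw [← real_inner_self_eq_norm_sq, ← real_inner_smul_left, ← inner_add_left, smul_sub,
        add_sub_cancel]
    have hn : ‖p x‖ ^ 2 ≤ 2 * ‖p x - q x‖ ^ 2 + 2 * ‖q x‖ ^ 2 := by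
      have h := norm_add_le (p x - q x) (q x)
      rw [sub_add_cancel] at h
      nlinarith [norm_nonneg (p x), norm_nonneg (p x - q x), norm_nonneg (q x),
        sq_nonneg (‖p x - q x‖ - ‖q x‖)]
    have t1 := mul_le_mul_of_nonneg_right hcx (sq_nonneg ‖p x - q x‖)
    have t2 := mul_le_mul_of_nonneg_left hn (mul_nonneg hb (hf x))
    have t3 := mul_le_mul_of_nonneg_right (le_abs_self (a₂ x)) (hf x)
    rw [e]
    linarith
  have hint := integral_mono_ae ((T0.const_mul (1 / 2)).add (T5.add T2))
    (T1.add (T3.add (T4.const_mul (2 * b)))) hpt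
  rw [integral_add' (T0.const_mul (1 / 2)) (T5.add T2), integral_add' T5 T2, integral_add' T1
    (T3.add (T4.const_mul (2 * b))), integral_add' T3 (T4.const_mul (2 * b)), integral_const_mul,
    integral_const_mul] at hint
  linarith

variable {N : ℕ} {Ω : Set (EuclideanSpace ℝ (Fin N))} {a : EuclideanSpace ℝ (Fin N) → ℝ → ℝ}
  {a₂ : EuclideanSpace ℝ (Fin N) → ℝ} {b₂ : ℝ}

/-- The inequality tested with `F (u - z)`. -/
lemma SatisfiesInequality.integral_le_comp (hΩ : IsOpen Ω)
    {u z : H01 Ω} (hu : SatisfiesInequality a a₂ b₂ u)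
    {F : ℝ → ℝ} {B L : ℝ} (hF : ContDiff ℝ ∞ F) (hF0 : F 0 = 0) (hB : ∀ s, |F s| ≤ B)
    (hL : ∀ s, |deriv F s| ≤ L) :
    ∫ x in Ω, ⟪(a x (sobolevFun u x) * deriv F (sobolevFun u x - sobolevFun z x)) •
        sobolevGrad u x, sobolevGrad u x - sobolevGrad z x⟫_ℝ ≤
      ∫ x in Ω, (a₂ x + b₂ * ‖sobolevGrad u x‖ ^ 2) *
        |F (sobolevFun u x - sobolevFun z x)| := by
  obtain ⟨v, hv, hgv⟩ := exists_comp_left hΩ (u - z) hF hF0 hL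
  have hvb : IsLinfty v := by
    refine memLp_top_of_bound (memLp_sobolevFun v).1 B ?_
    filter_upwards [hv] with x h1
    rw [h1]
    exact hB _
  have h := (le_abs_self _).trans (hu v hvb)
  refine le_of_eq_of_le ?_ (h.trans_eq ?_)
  · refine integral_congr_ae ?_
    filter_upwards [hgv, sobolevFun_sub u z, sobolevGrad_sub u z] with x h1 h2 h3
    rw [h1, h2, h3, real_inner_smul_right, real_inner_smul_left]
    ring
  · refine integral_congr_ae ?_
    filter_upwards [hv, sobolevFun_sub u z] with x h1 h2
    rw [h1, h2]

lemma aestronglyMeasurable_test_coefficient (hΩ : IsOpen Ω)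
    (ha : ContinuousOn (fun p : EuclideanSpace ℝ (Fin N) × ℝ => a p.1 p.2) (closure Ω ×ˢ univ))
    (u z : H01 Ω) {F : ℝ → ℝ} (hF : ContDiff ℝ ∞ F) :
    AEStronglyMeasurable (fun x => a x (sobolevFun u x) *
      deriv F (sobolevFun u x - sobolevFun z x)) (volume.restrict Ω) :=
  (aestronglyMeasurable_coefficient hΩ ha (memLp_sobolevFun u).1).mul
    ((hF.continuous_deriv (by simp)).comp_aestronglyMeasurable
      ((memLp_sobolevFun u).1.sub (memLp_sobolevFun z).1))

lemma ae_test_coefficient_le (hΩ : IsOpen Ω) {M A : ℝ} (hA0 : 0 ≤ A)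
    (hA : ∀ x ∈ Ω, ∀ s, |s| ≤ M → |a x s| ≤ A) {u z : H01 Ω}
    (huM : ∀ᵐ x ∂volume.restrict Ω, |sobolevFun u x| ≤ M)
    {F : ℝ → ℝ} {L : ℝ} (hL : ∀ s, |deriv F s| ≤ L) :
    ∀ᵐ x ∂volume.restrict Ω,
      ‖a x (sobolevFun u x) * deriv F (sobolevFun u x - sobolevFun z x)‖ ≤ A * L := by
  filter_upwards [huM, ae_restrict_mem hΩ.measurableSet] with x h1 h2
  rw [norm_mul]
  exact mul_le_mul (hA x h2 _ h1) (hL _) (norm_nonneg _) hA0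

/-- The energy estimate obtained by testing the inequality with `F (u - z)`. -/
lemma SatisfiesInequality.energy_le (hΩ : IsOpen Ω) (hb : Bornology.IsBounded Ω)
    (ha : ContinuousOn (fun p : EuclideanSpace ℝ (Fin N) × ℝ => a p.1 p.2) (closure Ω ×ˢ univ))
    (ha_one : ∀ x ∈ Ω, ∀ s : ℝ, 1 ≤ a x s) (ha₂ : MemLp a₂ 2 (volume.restrict Ω)) (hb₂ : 0 ≤ b₂)
    {u z : H01 Ω} {M : ℝ} (hu : SatisfiesInequality a a₂ b₂ u)
    (huM : ∀ᵐ x ∂volume.restrict Ω, |sobolevFun u x| ≤ M)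
    (hzM : ∀ᵐ x ∂volume.restrict Ω, |sobolevFun z x| ≤ M)
    {F : ℝ → ℝ} {B L : ℝ} (hF : ContDiff ℝ ∞ F) (hF0 : F 0 = 0) (hB : ∀ s, |F s| ≤ B)
    (hL : ∀ s, |deriv F s| ≤ L)
    (hdom : ∀ s, |s| ≤ 2 * M → 1 / 2 + 2 * b₂ * |F s| ≤ deriv F s) :
    1 / 2 * (∫ x in Ω, ‖sobolevGrad u x - sobolevGrad z x‖ ^ 2) ≤
      (∫ x in Ω, |a₂ x| * |F (sobolevFun u x - sobolevFun z x)|) +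
      2 * b₂ * (∫ x in Ω, ‖sobolevGrad z x‖ ^ 2 * |F (sobolevFun u x - sobolevFun z x)|) -
      ∫ x in Ω, ⟪(a x (sobolevFun u x) * deriv F (sobolevFun u x - sobolevFun z x)) •
        sobolevGrad z x, sobolevGrad u x - sobolevGrad z x⟫_ℝ := by
  have hΩf : IsFiniteMeasure (volume.restrict Ω) := ⟨by simpa using hb.measure_lt_top⟩
  obtain ⟨A, hA0, hA⟩ := exists_coefficient_bound hb ha M
  refine half_integral_norm_sub_sq_le (C := A * L) (B := B) (memLp_sobolevGrad u)
    (memLp_sobolevGrad z) (ha₂.integrable (by norm_num)) hb₂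
    (aestronglyMeasurable_test_coefficient hΩ ha u z hF)
    (ae_test_coefficient_le hΩ hA0 hA huM hL)
    (hF.continuous.abs.comp_aestronglyMeasurable
      ((memLp_sobolevFun u).1.sub (memLp_sobolevFun z).1))
    (Eventually.of_forall fun x => (abs_abs _).trans_le (hB _)) (fun x => abs_nonneg _) ?_
    (hu.integral_le_comp hΩ hF hF0 hB hL)
  filter_upwards [huM, hzM, ae_restrict_mem hΩ.measurableSet] with x h1 h2 h3
  have hs : |sobolevFun u x - sobolevFun z x| ≤ 2 * M := by
    have := abs_sub (sobolevFun u x) (sobolevFun z x)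
    linarith
  have hd := hdom _ hs
  -- The domination of `F'` makes it nonnegative, so multiplying by `a ≥ 1` preserves the lower
  -- bound.
  exact hd.trans (le_mul_of_one_le_left (le_trans (by positivity) hd) (ha_one x h3 _))

end Energy

/-! ### A priori bound, strong convergence and stability of the inequality -/

section Compactness

lemma norm_sub_sq_tendsto_zero {H : Type*} [NormedAddCommGroup H] {x : ℕ → H} {y : H}
    (h : Tendsto (fun n => ‖x n - y‖ ^ 2) atTop (𝓝 0)) : Tendsto x atTop (𝓝 y) := by
  rw [tendsto_iff_norm_sub_tendsto_zero]
  simpa [Real.sqrt_sq (norm_nonneg _)] using h.sqrt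

variable {N : ℕ} {Ω : Set (EuclideanSpace ℝ (Fin N))}

instance : TopologicalSpace.SeparableSpace (L2Pair Ω) := by
  have : Fact ((2 : ℝ≥0∞) ≠ ⊤) := ⟨by norm_num⟩
  have : SecondCountableTopology (Lp ℝ 2 (volume.restrict Ω)) := inferInstance
  have : SecondCountableTopology (Lp (EuclideanSpace ℝ (Fin N)) 2 (volume.restrict Ω)) :=
    inferInstance
  have : SecondCountableTopology (L2Pair Ω) :=
    (WithLp.homeomorphProd 2 (Lp ℝ 2 (volume.restrict Ω))
      (Lp (EuclideanSpace ℝ (Fin N)) 2 (volume.restrict Ω))).secondCountableTopology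
  infer_instance

/-- A bounded sequence of `H₀¹(Ω)` has a weakly convergent subsequence. -/
lemma exists_subseq_weak {u : ℕ → H01 Ω} {C : ℝ} (hu : ∀ n, ‖u n‖ ≤ C) :
    ∃ (z : H01 Ω) (k : ℕ → ℕ), StrictMono k ∧ ∀ y : L2Pair Ω,
      Tendsto (fun n => ⟪((u (k n) - z : H01 Ω) : H1 Ω).1, y⟫_ℝ) atTop (𝓝 0) := by
  obtain ⟨z, k, hk, h⟩ := exists_subseq_tendsto_inner (H := L2Pair Ω)
    (x := fun n => ((u n : H1 Ω) : L2Pair Ω)) hu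
  have hz : z ∈ (H01 Ω).map (H1 Ω).subtype := mem_of_tendsto_inner isClosed_map_H01
    (x := fun n => ((u (k n) : H1 Ω) : L2Pair Ω))
    (fun n => Submodule.mem_map_of_mem (u (k n)).2) h
  obtain ⟨w, hw, rfl⟩ := hz
  refine ⟨⟨w, hw⟩, k, hk, fun y => ?_⟩
  have h1 := (h y).sub_const ⟪(w : L2Pair Ω), y⟫_ℝ
  simp only [Submodule.subtype_apply, sub_self, ← inner_sub_left] at h1
  exact h1

/-- A bounded sequence of `H₀¹(Ω)` has a subsequence which converges weakly and almost
everywhere. -/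
lemma exists_subseq_weak_ae (hΩ : IsOpen Ω) (hb : Bornology.IsBounded Ω) {u : ℕ → H01 Ω} {C : ℝ}
    (hu : ∀ n, ‖u n‖ ≤ C) :
    ∃ (z : H01 Ω) (k : ℕ → ℕ), StrictMono k ∧ (∀ y : L2Pair Ω,
      Tendsto (fun n => ⟪((u (k n) - z : H01 Ω) : H1 Ω).1, y⟫_ℝ) atTop (𝓝 0)) ∧
      Tendsto (fun n => ∫ x in Ω, ‖sobolevFun (u (k n)) x - sobolevFun z x‖ ^ 2) atTop (𝓝 0) ∧
      ∀ᵐ x ∂volume.restrict Ω,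
        Tendsto (fun n => sobolevFun (u (k n)) x) atTop (𝓝 (sobolevFun z x)) := by
  obtain ⟨z, k, hk, h⟩ := exists_subseq_weak hu
  have h1 := tendsto_integral_sobolevFun_sq hΩ hb (w := fun n => u (k n) - z) (C := C + ‖z‖)
    (fun n => (norm_sub_le _ _).trans (add_le_add_left (hu _) _)) h
  have h2 : Tendsto (fun n => ∫ x in Ω, ‖sobolevFun (u (k n)) x - sobolevFun z x‖ ^ 2)
      atTop (𝓝 0) := by
    refine h1.congr fun n => integral_congr_ae ?_
    filter_upwards [sobolevFun_sub (u (k n)) z] with x hx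
    rw [hx]
  obtain ⟨j, hj, hae⟩ := exists_subseq_tendsto_ae (fun n => memLp_sobolevFun (u (k n)))
    (memLp_sobolevFun z) h2
  exact ⟨z, k ∘ j, hk.comp hj, fun y => (h y).comp hj.tendsto_atTop, h2.comp hj.tendsto_atTop, hae⟩

lemma integral_norm_grad_sq_le (u : H01 Ω) : ∫ x in Ω, ‖sobolevGrad u x‖ ^ 2 ≤ ‖u‖ ^ 2 := by
  have h := norm_sub_sq_eq_add u 0
  rw [sub_zero] at h
  have h1 : ∫ x in Ω, ‖sobolevGrad u x - sobolevGrad (0 : H01 Ω) x‖ ^ 2 =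
      ∫ x in Ω, ‖sobolevGrad u x‖ ^ 2 := integral_congr_ae (by
    filter_upwards [sobolevGrad_zero (Ω := Ω)] with x hx
    rw [hx, Pi.zero_apply, sub_zero])
  have h2 : 0 ≤ ∫ x in Ω, ‖sobolevFun u x - sobolevFun (0 : H01 Ω) x‖ ^ 2 :=
    integral_nonneg fun _ => by positivity
  linarith

variable {a : EuclideanSpace ℝ (Fin N) → ℝ → ℝ}
  {a₂ : EuclideanSpace ℝ (Fin N) → ℝ} {b₂ : ℝ}

/-- Solutions with a common `L^∞` bound are bounded in `H₀¹(Ω)`. -/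
lemma exists_norm_le (hΩ : IsOpen Ω) (hb : Bornology.IsBounded Ω)
    (ha : ContinuousOn (fun p : EuclideanSpace ℝ (Fin N) × ℝ => a p.1 p.2) (closure Ω ×ˢ univ))
    (ha_one : ∀ x ∈ Ω, ∀ s : ℝ, 1 ≤ a x s) (ha₂ : MemLp a₂ 2 (volume.restrict Ω)) (hb₂ : 0 ≤ b₂)
    {M : ℝ} (hM : 0 ≤ M) : ∃ C : ℝ, ∀ u : H01 Ω, SatisfiesInequality a a₂ b₂ u →
      (∀ᵐ x ∂volume.restrict Ω, |sobolevFun u x| ≤ M) → ‖u‖ ≤ C := by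
  have hΩf : IsFiniteMeasure (volume.restrict Ω) := ⟨by simpa using hb.measure_lt_top⟩
  obtain ⟨F, B, L, hF, hF0, hB, hL, hdom⟩ := exists_smooth_dominating b₂ (2 * M) hb₂ (by positivity)
  have ia₂ : Integrable a₂ (volume.restrict Ω) := ha₂.integrable (by norm_num)
  -- The constant adds `∫ M²` for the function and `2 ∫ |a₂| B` for the gradient; with `z = 0` the
  -- other two terms of the energy estimate vanish.
  refine ⟨Real.sqrt ((∫ _ in Ω, M ^ 2) + 2 * ∫ x in Ω, |a₂ x| * B), fun u hu huM => ?_⟩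
  refine Real.le_sqrt_of_sq_le ?_
  have h0 : ∀ᵐ x ∂volume.restrict Ω, |sobolevFun (0 : H01 Ω) x| ≤ M := by
    filter_upwards [sobolevFun_zero (Ω := Ω)] with x hx
    simpa [hx] using hM
  have h := hu.energy_le hΩ hb ha ha_one ha₂ hb₂ huM h0 hF hF0 hB hL hdom
  have e1 : ∫ x in Ω, ‖sobolevGrad (0 : H01 Ω) x‖ ^ 2 *
      |F (sobolevFun u x - sobolevFun (0 : H01 Ω) x)| = 0 := integral_eq_zero_of_ae (by
    filter_upwards [sobolevGrad_zero (Ω := Ω)] with x hx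
    simp [hx])
  have e2 : ∫ x in Ω, ⟪(a x (sobolevFun u x) *
      deriv F (sobolevFun u x - sobolevFun (0 : H01 Ω) x)) • sobolevGrad (0 : H01 Ω) x,
      sobolevGrad u x - sobolevGrad (0 : H01 Ω) x⟫_ℝ = 0 := integral_eq_zero_of_ae (by
    filter_upwards [sobolevGrad_zero (Ω := Ω)] with x hx
    simp [hx])
  rw [e1, e2] at h
  have h3 : ∫ x in Ω, |a₂ x| * |F (sobolevFun u x - sobolevFun (0 : H01 Ω) x)| ≤
      ∫ x in Ω, |a₂ x| * B := by
    refine integral_mono_of_nonneg (Eventually.of_forall fun x => by positivity)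
      (ia₂.abs.mul_const B) (Eventually.of_forall fun x => ?_)
    exact mul_le_mul_of_nonneg_left (hB _) (abs_nonneg _)
  have h4 : ∫ x in Ω, ‖sobolevFun u x - sobolevFun (0 : H01 Ω) x‖ ^ 2 ≤ ∫ _ in Ω, M ^ 2 := by
    refine integral_mono_of_nonneg (Eventually.of_forall fun x => by positivity)
      (integrable_const _) ?_
    filter_upwards [huM, sobolevFun_zero (Ω := Ω)] with x h1 h2
    rw [h2, Pi.zero_apply, sub_zero]
    exact pow_le_pow_left₀ (norm_nonneg _) h1 2
  have h5 := norm_sub_sq_eq_add u 0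
  rw [sub_zero] at h5
  linarith

/-- Weak and almost everywhere convergence of solutions implies strong convergence. -/
lemma tendsto_of_weak (hΩ : IsOpen Ω) (hb : Bornology.IsBounded Ω)
    (ha : ContinuousOn (fun p : EuclideanSpace ℝ (Fin N) × ℝ => a p.1 p.2) (closure Ω ×ˢ univ))
    (ha_one : ∀ x ∈ Ω, ∀ s : ℝ, 1 ≤ a x s) (ha₂ : MemLp a₂ 2 (volume.restrict Ω)) (hb₂ : 0 ≤ b₂)
    {M C : ℝ} (hM : 0 ≤ M) {u : ℕ → H01 Ω} {z : H01 Ω}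
    (hu : ∀ n, SatisfiesInequality a a₂ b₂ (u n))
    (huM : ∀ n, ∀ᵐ x ∂volume.restrict Ω, |sobolevFun (u n) x| ≤ M)
    (hzM : ∀ᵐ x ∂volume.restrict Ω, |sobolevFun z x| ≤ M) (hC : ∀ n, ‖u n‖ ≤ C)
    (hweak : ∀ y : L2Pair Ω, Tendsto (fun n => ⟪((u n - z : H01 Ω) : H1 Ω).1, y⟫_ℝ) atTop (𝓝 0))
    (hL2 : Tendsto (fun n => ∫ x in Ω, ‖sobolevFun (u n) x - sobolevFun z x‖ ^ 2) atTop (𝓝 0))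
    (hae : ∀ᵐ x ∂volume.restrict Ω,
        Tendsto (fun n => sobolevFun (u n) x) atTop (𝓝 (sobolevFun z x))) :
    Tendsto u atTop (𝓝 z) := by
  have hΩf : IsFiniteMeasure (volume.restrict Ω) := ⟨by simpa using hb.measure_lt_top⟩
  obtain ⟨F, B, L, hF, hF0, hB, hL, hdom⟩ := exists_smooth_dominating b₂ (2 * M) hb₂ (by positivity)
  obtain ⟨A, hA0, hA⟩ := exists_coefficient_bound hb ha M
  have hdc : Continuous (deriv F) := hF.continuous_deriv (by simp)
  have hFm : ∀ n, AEStronglyMeasurable (fun x => |F (sobolevFun (u n) x - sobolevFun z x)|)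
      (volume.restrict Ω) := fun n => hF.continuous.abs.comp_aestronglyMeasurable
      ((memLp_sobolevFun (u n)).1.sub (memLp_sobolevFun z).1)
  -- Dominated convergence: `F` is bounded by `B`, continuous and zero at zero, so only
  -- integrability of the weight `g` is needed. The weights used are `|a₂|` and `‖∇z‖²`.
  have hFlim : ∀ g : EuclideanSpace ℝ (Fin N) → ℝ, (∀ x, 0 ≤ g x) →
      Integrable g (volume.restrict Ω) →
      Tendsto (fun n => ∫ x in Ω, g x * |F (sobolevFun (u n) x - sobolevFun z x)|)
        atTop (𝓝 0) := fun g hg ig => by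
    have := tendsto_integral_of_dominated_convergence (μ := volume.restrict Ω)
      (F := fun n x => g x * |F (sobolevFun (u n) x - sobolevFun z x)|) (f := fun _ => 0)
      (fun x => g x * B) (fun n => ig.1.mul (hFm n)) (ig.mul_const B)
      (fun n => Eventually.of_forall fun x => ?_) ?_
    · simpa using this
    · rw [norm_mul, Real.norm_of_nonneg (hg x), Real.norm_of_nonneg (abs_nonneg _)]
      exact mul_le_mul_of_nonneg_left (hB _) (hg x)
    · filter_upwards [hae] with x hx
      have h1 := ((hF.continuous.abs.tendsto _).comp
        (hx.sub_const (sobolevFun z x))).const_mul (g x)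
      simpa [Function.comp_def, hF0] using h1
  have T3 := hFlim (fun x => |a₂ x|) (fun x => abs_nonneg _) (ha₂.integrable (by norm_num)).abs
  have T4 := hFlim (fun x => ‖sobolevGrad z x‖ ^ 2) (fun x => sq_nonneg _)
    (integrable_norm_sq (memLp_sobolevGrad z))
  have hcm := fun n => aestronglyMeasurable_test_coefficient hΩ ha (u n) z hF
  have hcm₀ := aestronglyMeasurable_test_coefficient hΩ ha z z hF
  have hcA := fun n => ae_test_coefficient_le (z := z) hΩ hA0 hA (huM n) hL
  have hcA₀ := ae_test_coefficient_le (z := z) hΩ hA0 hA hzM hL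
  have m₀ := memLp_smul_of_bound hcm₀ hcA₀ (memLp_sobolevGrad z)
  -- The fields `a(x, uₙ) F'(uₙ - z) ∇z` converge in `L²` by dominated convergence to `a(x, z) F'(0)
  -- ∇z`, while `∇(uₙ - z)` is bounded and weakly null; hence their pairing tends to zero.
  have T5 := tendsto_integral_inner (μ := volume.restrict Ω) (l := 0)
    (C := (C + ‖z‖) ^ 2)
    (fun n => memLp_smul_of_bound (hcm n) (hcA n) (memLp_sobolevGrad z)) m₀
    (fun n => (memLp_sobolevGrad (u n)).sub (memLp_sobolevGrad z))
    (tendsto_integral_norm_sub_sq (B := fun x => A * L * ‖sobolevGrad z x‖)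
      (fun n => (memLp_smul_of_bound (hcm n) (hcA n) (memLp_sobolevGrad z)).1)
      ((memLp_sobolevGrad z).norm.const_mul _)
      (fun n => by
        filter_upwards [hcA n] with x hx
        rw [norm_smul]
        exact mul_le_mul_of_nonneg_right hx (norm_nonneg _))
      (by
        filter_upwards [hae, ae_restrict_mem hΩ.measurableSet] with x hx hxΩ
        exact ((tendsto_coefficient ha hxΩ hx).mul
          ((hdc.tendsto _).comp (hx.sub_const _))).smul_const _))
    (fun n => by
      have h1 := integral_norm_grad_sq_le (u n - z)
      have h2 : ‖u n - z‖ ≤ C + ‖z‖ := (norm_sub_le _ _).trans (add_le_add_left (hC n) _)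
      have h3 := pow_le_pow_left₀ (norm_nonneg _) h2 2
      refine le_of_eq_of_le (integral_congr_ae ?_) (h1.trans h3)
      filter_upwards [sobolevGrad_sub (u n) z] with x hx
      rw [hx, Pi.sub_apply])
    (by
      refine (hweak (WithLp.toLp 2 (0, m₀.toLp _))).congr fun n => ?_
      refine (L2Pair.inner_eq (w := WithLp.toLp 2 (0, m₀.toLp _)) (sobolevFun_sub (u n) z)
        (Lp.coeFn_zero _ _ _)
        (sobolevGrad_sub (u n) z) m₀.coeFn_toLp).trans ?_
      simp only [Pi.zero_apply, mul_zero, integral_zero, zero_add, Pi.sub_apply, real_inner_comm])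
  have hgrad : Tendsto (fun n => ∫ x in Ω, ‖sobolevGrad (u n) x - sobolevGrad z x‖ ^ 2)
      atTop (𝓝 0) := by
    have hlim := (((T3.add (T4.const_mul (2 * b₂))).sub T5).const_mul 2)
    rw [mul_zero, add_zero, sub_zero, mul_zero] at hlim
    refine squeeze_zero (fun n => integral_nonneg fun _ => by positivity) (fun n => ?_) hlim
    have h := (hu n).energy_le hΩ hb ha ha_one ha₂ hb₂ (huM n) hzM hF hF0 hB hL hdom
    simp only [Pi.sub_apply]
    linarith
  refine norm_sub_sq_tendsto_zero ?_
  refine Tendsto.congr (fun n => (norm_sub_sq_eq_add (u n) z).symm) ?_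
  simpa using hL2.add hgrad

/-- The inequality is stable under strong convergence together with almost everywhere
convergence. -/
lemma SatisfiesInequality.of_tendsto (hΩ : IsOpen Ω) (hb : Bornology.IsBounded Ω)
    (ha : ContinuousOn (fun p : EuclideanSpace ℝ (Fin N) × ℝ => a p.1 p.2) (closure Ω ×ˢ univ))
    (ha₂ : MemLp a₂ 2 (volume.restrict Ω))
    {M : ℝ} {u : ℕ → H01 Ω} {z : H01 Ω}
    (hu : ∀ n, SatisfiesInequality a a₂ b₂ (u n))
    (huM : ∀ n, ∀ᵐ x ∂volume.restrict Ω, |sobolevFun (u n) x| ≤ M)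
    (hlim : Tendsto u atTop (𝓝 z))
    (hae : ∀ᵐ x ∂volume.restrict Ω,
        Tendsto (fun n => sobolevFun (u n) x) atTop (𝓝 (sobolevFun z x))) :
    SatisfiesInequality a a₂ b₂ z := by
  have hΩf : IsFiniteMeasure (volume.restrict Ω) := ⟨by simpa using hb.measure_lt_top⟩
  obtain ⟨A, hA0, hA⟩ := exists_coefficient_bound hb ha M
  intro v hv
  have ia₂ : Integrable a₂ (volume.restrict Ω) := ha₂.integrable (by norm_num)
  obtain ⟨V, hV⟩ : ∃ V, ∀ᵐ x ∂volume.restrict Ω, ‖sobolevFun v x‖ ≤ V := 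
    ⟨_, ae_le_lpNorm_exponent_top hv⟩
  have hgrad : Tendsto (fun n => ∫ x in Ω, ‖sobolevGrad (u n) x - sobolevGrad z x‖ ^ 2)
      atTop (𝓝 0) := by
    have h := (tendsto_iff_norm_sub_tendsto_zero.1 hlim).pow 2
    rw [zero_pow two_ne_zero] at h
    refine squeeze_zero (fun n => integral_nonneg fun _ => by positivity) (fun n => ?_) h
    refine le_of_le_of_eq ?_ (norm_sub_sq_eq_add (u n) z).symm
    exact le_add_of_nonneg_left (integral_nonneg fun _ => by positivity)
  have hzM : ∀ᵐ x ∂volume.restrict Ω, |sobolevFun z x| ≤ M := by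
    filter_upwards [hae, ae_all_iff.2 huM] with x h1 h2
    exact le_of_tendsto h1.abs (Eventually.of_forall h2)
  have hcm : ∀ w : H01 Ω, AEStronglyMeasurable (fun x => a x (sobolevFun w x))
      (volume.restrict Ω) := fun w =>
    aestronglyMeasurable_coefficient hΩ ha (memLp_sobolevFun w).1
  have hcA : ∀ w : H01 Ω, (∀ᵐ x ∂volume.restrict Ω, |sobolevFun w x| ≤ M) →
      ∀ᵐ x ∂volume.restrict Ω, ‖a x (sobolevFun w x)‖ ≤ A := fun w hw => by
    filter_upwards [hw, ae_restrict_mem hΩ.measurableSet] with x h1 h2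
    exact hA x h2 _ h1
  -- The coefficient is attached to the fixed field `∇v`, so that `a(x, uₙ) ∇v` converges in `L²` by
  -- dominated convergence.
  have hleft := tendsto_integral_inner_of_tendsto (μ := volume.restrict Ω)
    (fun n => memLp_smul_of_bound (hcm (u n)) (hcA (u n) (huM n)) (memLp_sobolevGrad v))
    (memLp_smul_of_bound (hcm z) (hcA z hzM) (memLp_sobolevGrad v))
    (fun n => memLp_sobolevGrad (u n)) (memLp_sobolevGrad z)
    (tendsto_integral_norm_sub_sq (B := fun x => A * ‖sobolevGrad v x‖)
      (fun n => (memLp_smul_of_bound (hcm (u n)) (hcA (u n) (huM n)) (memLp_sobolevGrad v)).1)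
      ((memLp_sobolevGrad v).norm.const_mul _)
      (fun n => by
        filter_upwards [hcA (u n) (huM n)] with x hx
        rw [norm_smul]
        exact mul_le_mul_of_nonneg_right hx (norm_nonneg _))
      (by
        filter_upwards [hae, ae_restrict_mem hΩ.measurableSet] with x hx hxΩ
        exact (tendsto_coefficient ha hxΩ hx).smul_const _))
    hgrad
  have hvm : AEStronglyMeasurable (fun x => |sobolevFun v x|) (volume.restrict Ω) :=
    (memLp_sobolevFun v).1.norm
  have hvV : ∀ᵐ x ∂volume.restrict Ω, ‖|sobolevFun v x|‖ ≤ V := by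
    filter_upwards [hV] with x hx
    simpa using hx
  have mv : ∀ w : H01 Ω, MemLp (fun x => |sobolevFun v x| • sobolevGrad w x) 2
      (volume.restrict Ω) := fun w => memLp_smul_of_bound hvm hvV (memLp_sobolevGrad w)
  -- The quadratic term is the pairing of `|v| ∇uₙ` with `∇uₙ`; both converge in `L²` because `v` is
  -- bounded.
  have hright := tendsto_integral_inner_of_tendsto (μ := volume.restrict Ω)
    (fun n => mv (u n)) (mv z) (fun n => memLp_sobolevGrad (u n)) (memLp_sobolevGrad z)
    (by
      have h := hgrad.const_mul (V ^ 2)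
      rw [mul_zero] at h
      refine squeeze_zero (fun n => integral_nonneg fun _ => by positivity) (fun n => ?_) h
      rw [← integral_const_mul]
      refine integral_mono_ae (integrable_norm_sq ((mv (u n)).sub (mv z)))
        ((integrable_norm_sq ((memLp_sobolevGrad (u n)).sub (memLp_sobolevGrad z))).const_mul _) ?_
      filter_upwards [hvV] with x hx
      rw [← smul_sub, norm_smul, ← mul_pow]
      exact pow_le_pow_left₀ (by positivity) (mul_le_mul_of_nonneg_right hx (norm_nonneg _)) 2)
    hgrad
  have e1 : ∀ w : H01 Ω, ∫ x in Ω, ⟪a x (sobolevFun w x) • sobolevGrad v x, sobolevGrad w x⟫_ℝ =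
      ∫ x in Ω, a x (sobolevFun w x) * ⟪sobolevGrad w x, sobolevGrad v x⟫_ℝ := fun w => by
    simp only [real_inner_smul_left, fun x => real_inner_comm (sobolevGrad w x) (sobolevGrad v x)]
  have ev : Integrable (fun x => a₂ x * |sobolevFun v x|) (volume.restrict Ω) :=
    ia₂.mul_bdd hvm hvV
  have e2 : ∀ w : H01 Ω, (∫ x in Ω, a₂ x * |sobolevFun v x|) +
      b₂ * ∫ x in Ω, ⟪|sobolevFun v x| • sobolevGrad w x, sobolevGrad w x⟫_ℝ =
      ∫ x in Ω, (a₂ x + b₂ * ‖sobolevGrad w x‖ ^ 2) * |sobolevFun v x| := fun w => by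
    rw [← integral_const_mul, ← integral_add ev
      ((integrable_inner_of_memLp (mv w) (memLp_sobolevGrad w)).const_mul b₂)]
    refine integral_congr_ae (Eventually.of_forall fun x => ?_)
    simp only [real_inner_smul_left, real_inner_self_eq_norm_sq]
    ring
  simp only [e1] at hleft
  have hR := (hright.const_mul b₂).const_add (∫ x in Ω, a₂ x * |sobolevFun v x|)
  simp only [e2] at hR
  exact le_of_tendsto_of_tendsto' hleft.abs hR fun n => hu n v hv

end Compactness

end

end BernsteinNagumo

/-! ### The compactness theorem -/

open BernsteinNagumo in
theorem mainTheorem5 {N : ℕ} (hN : 1 ≤ N) (Ω : Set (EuclideanSpace ℝ (Fin N)))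
    (hΩ : BernsteinNagumo.IsSmoothBoundedDomain Ω)
    (a : EuclideanSpace ℝ (Fin N) → ℝ → ℝ)
    (ha_smooth : ContDiffOn ℝ ∞ (fun p : EuclideanSpace ℝ (Fin N) × ℝ => a p.1 p.2)
      (closure Ω ×ˢ univ))
    (ha_one : ∀ x ∈ Ω, ∀ s : ℝ, 1 ≤ a x s)
    (a₁ b₁ : EuclideanSpace ℝ (Fin N) → ℝ)
    (ha₁ : MemLp a₁ ∞ (volume.restrict Ω)) (hb₁ : MemLp b₁ 2 (volume.restrict Ω))
    (ha_growth : ∀ᵐ x ∂volume.restrict Ω, ∀ s : ℝ, a x s ≤ a₁ x * |s| + b₁ x)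
    (ulo uhi : EuclideanSpace ℝ (Fin N) → ℝ)
    (hulo : ContinuousOn ulo (closure Ω)) (huhi : ContinuousOn uhi (closure Ω))
    (hle : ∀ x ∈ closure Ω, ulo x ≤ uhi x)
    (a₂ : EuclideanSpace ℝ (Fin N) → ℝ) (ha₂ : MemLp a₂ 2 (volume.restrict Ω))
    (b₂ : ℝ) (hb₂ : 0 ≤ b₂) :
    IsCompact (BernsteinNagumo.solutionSet Ω a a₂ b₂ ulo uhi) := by
  have hac := ha_smooth.continuousOn
  have hcpt := hΩ.isBounded.isCompact_closure
  obtain ⟨M₁, hM₁⟩ := hcpt.exists_bound_of_continuousOn hulo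
  obtain ⟨M₂, hM₂⟩ := hcpt.exists_bound_of_continuousOn huhi
  set M := max 0 (max M₁ M₂) with hMdef
  have hM : 0 ≤ M := le_max_left _ _
  have hmem : ∀ᵐ x ∂volume.restrict Ω, x ∈ closure Ω := by
    filter_upwards [ae_restrict_mem hΩ.isOpen.measurableSet] with x hx using subset_closure hx
  have hbound : ∀ w : H01 Ω, (∀ᵐ x ∂volume.restrict Ω, ulo x ≤ sobolevFun w x ∧
      sobolevFun w x ≤ uhi x) → ∀ᵐ x ∂volume.restrict Ω, |sobolevFun w x| ≤ M := fun w hw => by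
    filter_upwards [hw, hmem] with x h1 hx
    have h2 : M₁ ≤ M := (le_max_left _ _).trans (le_max_right _ _)
    have h3 : M₂ ≤ M := (le_max_right _ _).trans (le_max_right _ _)
    exact abs_le.2 ⟨by linarith [neg_le_of_abs_le (hM₁ x hx), h1.1],
      by linarith [le_of_abs_le (hM₂ x hx), h1.2]⟩
  obtain ⟨C, hC⟩ := exists_norm_le hΩ.isOpen hΩ.isBounded hac ha_one ha₂ hb₂ hM
  refine IsSeqCompact.isCompact fun u hu => ?_
  have huM := fun n => hbound (u n) (hu n).2.1
  have hnorm := fun n => hC (u n) (hu n).2.2 (huM n)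
  obtain ⟨z, k, hk, hweak, hL2, hae⟩ := exists_subseq_weak_ae hΩ.isOpen hΩ.isBounded hnorm
  -- The order bounds pass to the almost everywhere limit. They are needed before strong
  -- convergence, since the energy estimate requires `|z| ≤ M`.
  have hz : ∀ᵐ x ∂volume.restrict Ω, ulo x ≤ sobolevFun z x ∧ sobolevFun z x ≤ uhi x := by
    filter_upwards [hae, ae_all_iff.2 fun n => (hu (k n)).2.1] with x h1 h2
    exact ⟨ge_of_tendsto h1 (Eventually.of_forall fun n => (h2 n).1),
      le_of_tendsto h1 (Eventually.of_forall fun n => (h2 n).2)⟩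
  have hlim := tendsto_of_weak hΩ.isOpen hΩ.isBounded hac ha_one ha₂ hb₂ hM
    (fun n => (hu (k n)).2.2) (fun n => huM (k n)) (hbound z hz) (fun n => hnorm (k n))
    hweak hL2 hae
  exact ⟨z, ⟨memLp_top_of_bound (memLp_sobolevFun z).1 M (hbound z hz), hz,
    SatisfiesInequality.of_tendsto hΩ.isOpen hΩ.isBounded hac ha₂ (fun n => (hu (k n)).2.2)
      (fun n => huM (k n)) hlim hae⟩, k, hk, hlim⟩
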